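/- Let $N\ge1$ and let $2^\star=\frac{2N}{N-2}$ if $N\ge3$, $2^\star=\infty$ if $N\le2$. Let $H^1(\mathbb{R}^N)=H^1(\mathbb{R}^N;\mathbb{C})$ be regarded as a real Hilbert space with norm $\|u\|_{H^1}^2=\int_{\mathbb{R}^N}|u|^2\,dx+\int_{\mathbb{R}^N}|\nabla u|^2\,dx$, and let $H^{-1}(\mathbb{R}^N)$ be its topological dual (continuous $\mathbb{R}$-linear forms $H^1(\mathbb{R}^N)\to\mathbb{R}$, with the dual norm). Let $f:\mathbb{R}^N\times[0,\infty)\to\mathbb{R}$ be such that $x\mapsto f(x,t)$ is measurable for every $t\ge0$ and $t\mapsto f(x,t)$ is continuous for almost every $x$. Assume that for every $\varepsilon>0$ there exist $p_\varepsilon\in(2,2^\star)$ and $C_\varepsilon>0$ such that for almost every $x\in\mathbb{R}^N$ and every $t\ge0$, $$|f(x,t)|\le\varepsilon\,(t+t^{2^\star-1})+C_\varepsilon t^{p_\varepsilon-1}\ \text{ if } N\ge3,\qquad |f(x,t)|\le\varepsilon\,t+C_\varepsilon t^{p_\varepsilon-1}\ \text{ if } N\le2.$$ Put $F(x,t)=\int_0^tf(x,s)\,ds$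 for $t\ge0$. For measurable $u:\mathbb{R}^N\to\mathbb{C}$ let $g(u)(x)=f(x,|u(x)|)\frac{u(x)}{|u(x)|}$ if $u(x)\ne0$ and $g(u)(x)=f(x,0)$ if $u(x)=0$. For $u\in H^1(\mathbb{R}^N)$ let $\psi(u)=\int_{\mathbb{R}^N}F(x,|u(x)|)\,dx$. Then for every $u\in H^1(\mathbb{R}^N)$ the function $F(\cdot,|u|)$ is integrable, so that $\psi$ is well defined, $g(u)$ is locally integrable, and $g(u)$ defines an element of $H^{-1}(\mathbb{R}^N)$, still denoted by $g(u)$. Moreover, the following holds. 1. $\psi\in C^1(H^1(\mathbb{R}^N);\mathbb{R})$, $\psi'(u)=g(u)$ for every $u\in H^1(\mathbb{R}^N)$, and $\psi:H^1(\mathbb{R}^N)\to\mathbb{R}$ and $\psi':H^1(\mathbb{R}^N)\to H^{-1}(\mathbb{R}^N)$ are bounded on bounded sets. 2. For all $u,v\in H^1(\mathbb{R}^N)$, $g(u)\overline v$ is integrable and $\langle g(u),v\rangle_{H^{-1},H^1}=\operatorname{Re}\int_{\mathbb{R}^N}g(u)(x)\overline{v(x)}\,dx$. 3. If $(u_n)_n$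 and $(v_n)_n$ are bounded sequences in $H^1(\mathbb{R}^N)$ and $\lim_{n\to\infty}\|u_n-v_n\|_{L^p(\mathbb{R}^N)}=0$ for some $p\in[1,\infty]$, then $\lim_{n\to\infty}|\psi(u_n)-\psi(v_n)|=0$. 4. If $u_n\rightharpoonup u$ weakly in $H^1(\mathbb{R}^N)$, then $g(u_n)\rightharpoonup g(u)$ weakly in $H^{-1}(\mathbb{R}^N)$. -/

import Mathlib

open MeasureTheory Filter Topology
open scoped ENNReal ContDiff

noncomputable section

namespace SubcriticalFunctional

/-- Euclidean space `ℝᴺ`. -/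
abbrev E (N : ℕ) : Type := EuclideanSpace ℝ (Fin N)

/-- `G` is the weak gradient of `u`: for every real test function `φ` and every `i`,
`∫ (∂ᵢφ) u = - ∫ φ Gᵢ`. -/
def IsWeakGradient {N : ℕ} (u : E N → ℂ) (G : E N → EuclideanSpace ℂ (Fin N)) : Prop :=
  ∀ φ : E N → ℝ, ContDiff ℝ ∞ φ → HasCompactSupport φ → ∀ i : Fin N,
    ∫ x, (fderiv ℝ φ x (EuclideanSpace.single i 1)) • u x = - ∫ x, φ x • G x i

/-- The Hilbert product `L²(ℝᴺ; ℂ) × L²(ℝᴺ; ℂᴺ)`, with the norm `(‖u‖² + ‖G‖²)^{1/2}`. -/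
abbrev L2Pair (N : ℕ) : Type :=
  WithLp 2 (Lp ℂ 2 (volume : Measure (E N)) ×
    Lp (EuclideanSpace ℂ (Fin N)) 2 (volume : Measure (E N)))

theorem locallyIntegrable_fst {N : ℕ} (w : L2Pair N) :
    LocallyIntegrable (w.fst : E N → ℂ) volume :=
  (Lp.memLp w.fst).locallyIntegrable (by norm_num)

theorem locallyIntegrable_snd {N : ℕ} (w : L2Pair N) (i : Fin N) :
    LocallyIntegrable (fun x => (w.snd : E N → EuclideanSpace ℂ (Fin N)) x i) volume := by
  have h : MemLp (fun x => (w.snd : E N → EuclideanSpace ℂ (Fin N)) x i) 2 volume :=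
    (EuclideanSpace.proj (𝕜 := ℂ) i).comp_memLp' (Lp.memLp w.snd)
  exact h.locallyIntegrable (by norm_num)

theorem continuous_partial {N : ℕ} {φ : E N → ℝ} (hφ : ContDiff ℝ ∞ φ) (i : Fin N) :
    Continuous fun x => fderiv ℝ φ x (EuclideanSpace.single i 1) :=
  (hφ.continuous_fderiv (by simp)).clm_apply continuous_const

theorem hasCompactSupport_partial {N : ℕ} {φ : E N → ℝ} (hc : HasCompactSupport φ) (i : Fin N) :
    HasCompactSupport fun x => fderiv ℝ φ x (EuclideanSpace.single i 1) :=
  hc.fderiv_apply ℝ _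

theorem isWeakGradient_zero {N : ℕ} :
    IsWeakGradient ((0 : L2Pair N).fst) ((0 : L2Pair N).snd) := by
  intro φ hφ hc i
  have h1 : ((0 : L2Pair N).fst : E N → ℂ) =ᵐ[volume] 0 := Lp.coeFn_zero ..
  have h2 : ((0 : L2Pair N).snd : E N → EuclideanSpace ℂ (Fin N)) =ᵐ[volume] 0 :=
    Lp.coeFn_zero ..
  rw [integral_eq_zero_of_ae, integral_eq_zero_of_ae, neg_zero]
  · filter_upwards [h2] with x hx
    rw [hx]
    simp
  · filter_upwards [h1] with x hx
    rw [hx]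
    simp

theorem isWeakGradient_add {N : ℕ} {a b : L2Pair N} (ha : IsWeakGradient a.fst a.snd)
    (hb : IsWeakGradient b.fst b.snd) : IsWeakGradient (a + b).fst (a + b).snd := by
  intro φ hφ hc i
  have h1 : ((a + b).fst : E N → ℂ) =ᵐ[volume] _ := Lp.coeFn_add a.fst b.fst
  have h2 : ((a + b).snd : E N → EuclideanSpace ℂ (Fin N)) =ᵐ[volume] _ :=
    Lp.coeFn_add a.snd b.snd
  have e1 := integral_add
    ((locallyIntegrable_fst a).integrable_smul_left_of_hasCompactSupport
      (continuous_partial hφ i) (hasCompactSupport_partial hc i))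
    ((locallyIntegrable_fst b).integrable_smul_left_of_hasCompactSupport
      (continuous_partial hφ i) (hasCompactSupport_partial hc i))
  have e2 := integral_add
    ((locallyIntegrable_snd a i).integrable_smul_left_of_hasCompactSupport hφ.continuous hc)
    ((locallyIntegrable_snd b i).integrable_smul_left_of_hasCompactSupport hφ.continuous hc)
  have e3 := ha φ hφ hc i
  have e4 := hb φ hφ hc i
  rw [e3, e4, ← neg_add, ← e2] at e1
  refine (integral_congr_ae ?_).trans (e1.trans (congrArg Neg.neg (integral_congr_ae ?_)))
  · filter_upwards [h1] with x hx
    rw [hx, Pi.add_apply, smul_add]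
  · filter_upwards [h2] with x hx
    rw [hx, Pi.add_apply, PiLp.add_apply, smul_add]

theorem isWeakGradient_smul {N : ℕ} (c : ℝ) {a : L2Pair N} (ha : IsWeakGradient a.fst a.snd) :
    IsWeakGradient (c • a).fst (c • a).snd := by
  intro φ hφ hc i
  have h1 : ((c • a).fst : E N → ℂ) =ᵐ[volume] _ := Lp.coeFn_smul c a.fst
  have h2 : ((c • a).snd : E N → EuclideanSpace ℂ (Fin N)) =ᵐ[volume] _ :=
    Lp.coeFn_smul c a.snd
  have e := congrArg (fun z : ℂ => c • z) (ha φ hφ hc i)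
  simp only [smul_neg] at e
  rw [← integral_smul, ← integral_smul] at e
  refine (integral_congr_ae ?_).trans (e.trans (congrArg Neg.neg (integral_congr_ae ?_)))
  · filter_upwards [h1] with x hx
    rw [hx, Pi.smul_apply, smul_comm]
  · filter_upwards [h2] with x hx
    rw [hx, Pi.smul_apply, PiLp.smul_apply, smul_comm]

/-- The real Hilbert space `H¹(ℝᴺ) = H¹(ℝᴺ; ℂ)`. An element is a function `u ∈ L²(ℝᴺ; ℂ)`
together with its weak gradient `∇u ∈ L²(ℝᴺ; ℂᴺ)` (determined by `u`, see `H1_ext`), and the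
norm is `‖u‖² = ∫ |u|² + ∫ |∇u|²`. -/
def H1 (N : ℕ) : Submodule ℝ (L2Pair N) where
  carrier := {w | IsWeakGradient w.fst w.snd}
  zero_mem' := isWeakGradient_zero
  add_mem' := isWeakGradient_add
  smul_mem' := fun c _ h => isWeakGradient_smul c h

/-- The function underlying an element of `H¹(ℝᴺ)`. -/
def toFun {N : ℕ} (u : H1 N) : E N → ℂ := (u : L2Pair N).fst

/-- An element of `H¹(ℝᴺ)` is determined by its underlying function. -/
theorem H1_ext {N : ℕ} {u v : H1 N} (h : toFun u =ᵐ[volume] toFun v) : u = v := by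
  have h1 : (u : L2Pair N).fst = (v : L2Pair N).fst := Lp.ext h
  have h2 : (u : L2Pair N).snd = (v : L2Pair N).snd := by
    apply Lp.ext
    have key : ∀ i : Fin N, ∀ᵐ x ∂(volume : Measure (E N)),
        ((u : L2Pair N).snd : E N → EuclideanSpace ℂ (Fin N)) x i
          - ((v : L2Pair N).snd : E N → EuclideanSpace ℂ (Fin N)) x i = 0 := by
      intro i
      refine ae_eq_zero_of_integral_contDiff_smul_eq_zero
        ((locallyIntegrable_snd (u : L2Pair N) i).sub (locallyIntegrable_snd (v : L2Pair N) i)) ?_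
      intro φ hφ hc
      have e := integral_sub
        ((locallyIntegrable_snd (u : L2Pair N) i).integrable_smul_left_of_hasCompactSupport
          hφ.continuous hc)
        ((locallyIntegrable_snd (v : L2Pair N) i).integrable_smul_left_of_hasCompactSupport
          hφ.continuous hc)
      have eu := u.2 φ hφ hc i
      have ev := v.2 φ hφ hc i
      rw [h1, ev] at eu
      rw [neg_inj.mp eu, sub_self] at e
      simpa only [Pi.sub_apply, smul_sub] using e
    filter_upwards [ae_all_iff.mpr key] with x hx
    ext i
    exact sub_eq_zero.mp (hx i)
  apply Subtype.ext
  exact (WithLp.equiv 2 _).injective (Prod.ext h1 h2)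

/-- `H⁻¹(ℝᴺ)`: the topological dual of the real Hilbert space `H¹(ℝᴺ)`. -/
abbrev Hneg1 (N : ℕ) : Type := StrongDual ℝ (H1 N)

/-- The critical exponent `2⋆ = 2N/(N-2)`, with `2⋆ = ∞` if `N ≤ 2`. -/
def critExp (N : ℕ) : ℝ≥0∞ :=
  if N ≤ 2 then ⊤ else ENNReal.ofReal (2 * N / (N - 2))

/-- `f : ℝᴺ × [0,∞) → ℝ` is (Lebesgue) measurable in `x` and continuous in `t`.
Only the values `f x t` with `t ≥ 0` are relevant. -/
def IsCaratheodory {N : ℕ} (f : E N → ℝ → ℝ) : Prop :=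
  (∀ t : ℝ, 0 ≤ t → AEMeasurable (fun x => f x t) volume) ∧
    ∀ᵐ x : E N, ContinuousOn (f x) (Set.Ici 0)

/-- The subcritical growth condition on `f : ℝᴺ × [0,∞) → ℝ`. -/
def IsSubcritical {N : ℕ} (f : E N → ℝ → ℝ) : Prop :=
  ∀ ε : ℝ, 0 < ε → ∃ p C : ℝ, 2 < p ∧ ENNReal.ofReal p < critExp N ∧ 0 < C ∧
    ∀ᵐ x : E N, ∀ t : ℝ, 0 ≤ t →
      |f x t| ≤
        (if 3 ≤ N then ε * (t + t ^ ((critExp N).toReal - 1)) else ε * t) + C * t ^ (p - 1)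

/-- `F(x,t) = ∫₀ᵗ f(x,s) ds`. -/
def primitive {N : ℕ} (f : E N → ℝ → ℝ) (x : E N) (t : ℝ) : ℝ := ∫ s in (0 : ℝ)..t, f x s

/-- The extension of `f(x,·)` to the complex plane: `f(x,|z|) z/|z|` for `z ≠ 0`, and `f(x,0)`
for `z = 0`. -/
def extendC {N : ℕ} (f : E N → ℝ → ℝ) (x : E N) (z : ℂ) : ℂ :=
  if z = 0 then (f x 0 : ℂ) else (f x ‖z‖ : ℂ) * (z / (‖z‖ : ℂ))

/-- The superposition operator `g(u)(x) = f(x,u(x))`. -/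
def g {N : ℕ} (f : E N → ℝ → ℝ) (u : E N → ℂ) (x : E N) : ℂ := extendC f x (u x)

/-- `ψ(u) = ∫ F(x,|u(x)|) dx` for `u ∈ H¹(ℝᴺ)`. -/
def psi {N : ℕ} (f : E N → ℝ → ℝ) (u : H1 N) : ℝ := ∫ x, primitive f x ‖toFun u x‖

end SubcriticalFunctional

end

open MeasureTheory Filter Topology
open scoped ENNReal ContDiff

namespace SubcriticalFunctional

theorem ENNReal_rpow_le_add {a : ℝ≥0∞} {p q r : ℝ} (hpq : p ≤ q) (hqr : q ≤ r) :
    a ^ q ≤ a ^ p + a ^ r := by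
  rcases le_total a 1 with h | h
  · exact (ENNReal.rpow_le_rpow_of_exponent_ge h hpq).trans le_self_add
  · exact (ENNReal.rpow_le_rpow_of_exponent_le h hqr).trans le_add_self

theorem ENNReal_mul_le_sq_add_sq (a b : ℝ≥0∞) : a * b ≤ a ^ 2 + b ^ 2 := by
  rcases le_total a b with h | h
  · calc a * b ≤ b * b := by gcongr
      _ = b ^ 2 := (sq b).symm
      _ ≤ _ := le_add_self
  · calc a * b ≤ a * a := by gcongr
      _ = a ^ 2 := (sq a).symm
      _ ≤ _ := le_self_add

theorem enorm_fderiv_pow_le {V : Type*} [NormedAddCommGroup V] [NormedSpace ℝ V] {u : V → ℂ}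
    (hu : ContDiff ℝ 1 u) (k : ℕ) (x : V) :
    ‖fderiv ℝ (fun y => u y ^ (k + 1)) x‖ₑ ≤
      (k + 1 : ℕ) * (‖u x‖ₑ ^ k * ‖fderiv ℝ u x‖ₑ) := by
  have h : HasFDerivAt (fun y => u y ^ (k + 1)) _ x :=
    ((hu.differentiable one_ne_zero x).hasFDerivAt (𝕜 := ℝ)).pow (k + 1)
  rw [h.fderiv, enorm_smul, Nat.add_sub_cancel, nsmul_eq_mul, enorm_mul, enorm_pow, mul_assoc]
  gcongr
  rw [← ofReal_norm, Complex.norm_natCast, ENNReal.ofReal_natCast]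

/-- The total mass of `|u|^q` is controlled by the `H¹` norm, over `C¹` functions with compact
support. -/
def IsSobolevExponent (N : ℕ) (q : ℝ) : Prop :=
  ∀ M : ℝ≥0∞, M ≠ ⊤ → ∃ B : ℝ≥0∞, B ≠ ⊤ ∧ ∀ u : E N → ℂ, ContDiff ℝ 1 u → HasCompactSupport u →
    ∫⁻ x, ‖u x‖ₑ ^ 2 ≤ M → ∫⁻ x, ‖fderiv ℝ u x‖ₑ ^ 2 ≤ M → ∫⁻ x, ‖u x‖ₑ ^ q ≤ B

theorem IsSobolevExponent.interpolate {N : ℕ} {q r : ℝ} (h : IsSobolevExponent N r) (hq : 2 ≤ q)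
    (hqr : q ≤ r) : IsSobolevExponent N q := by
  intro M hM
  obtain ⟨B, hB, H⟩ := h M hM
  refine ⟨M + B, by finiteness, fun u hu hc h0 h1 => ?_⟩
  calc ∫⁻ x, ‖u x‖ₑ ^ q ≤ ∫⁻ x, (‖u x‖ₑ ^ 2 + ‖u x‖ₑ ^ r) := by
        refine lintegral_mono fun x => ?_
        have := ENNReal_rpow_le_add (a := ‖u x‖ₑ) hq hqr
        rwa [ENNReal.rpow_two] at this
    _ = (∫⁻ x, ‖u x‖ₑ ^ 2) + ∫⁻ x, ‖u x‖ₑ ^ r :=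
        lintegral_add_left (hu.continuous.measurable.enorm.pow_const 2) _
    _ ≤ M + B := add_le_add h0 (H u hu hc h0 h1)

theorem isSobolevExponent_of_three_le {N : ℕ} (hN : 3 ≤ N) :
    IsSobolevExponent N (2 * N / (N - 2)) := by
  intro M hM
  have hN' : (3 : ℝ) ≤ N := by exact_mod_cast hN
  have hq : (0 : ℝ) < 2 * N / (N - 2) := div_pos (by linarith) (by linarith)
  set q : NNReal := ⟨2 * N / (N - 2), hq.le⟩ with hqdef
  have hqc : (q : ℝ) = 2 * N / (N - 2) := rfl
  let C := SNormLESNormFDerivOfEqConst ℂ (volume : Measure (E N)) 2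
  refine ⟨(C * M ^ (1 / 2 : ℝ)) ^ (q : ℝ), by finiteness, fun u hu hc h0 h1 => ?_⟩
  have key := eLpNorm_le_eLpNorm_fderiv_of_eq (μ := (volume : Measure (E N))) (p := 2) (p' := q)
    hu hc (by norm_num) (by simp; omega) (by
      rw [hqc]
      simp only [finrank_euclideanSpace, Fintype.card_fin]
      rw [show (((2⁻¹ : NNReal) : ℝ)) = 2⁻¹ by norm_num]
      have : (N : ℝ) - 2 ≠ 0 := by linarith
      have : (N : ℝ) ≠ 0 := by linarith
      field_simp)
  have hq0 : (q : ℝ≥0∞) ≠ 0 := by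
    have : q ≠ 0 := fun h => hq.ne' (by rw [← hqc, h]; rfl)
    exact_mod_cast this
  rw [eLpNorm_eq_lintegral_rpow_enorm_toReal hq0 (by simp),
    eLpNorm_eq_lintegral_rpow_enorm_toReal (by simp) (by simp)] at key
  simp only [ENNReal.coe_toReal, ENNReal.coe_ofNat, ENNReal.toReal_ofNat, NNReal.coe_ofNat,
    ENNReal.rpow_ofNat] at key
  have key2 := ENNReal.rpow_le_rpow key hq.le
  rw [← hqc, ← ENNReal.rpow_mul, one_div, inv_mul_cancel₀ (by rw [hqc]; exact hq.ne'),
    ENNReal.rpow_one] at key2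
  rw [← hqc]
  refine key2.trans ?_
  gcongr

theorem isSobolevExponent_two (k : ℕ) : IsSobolevExponent 2 (2 * (k + 1)) := by
  induction k with
  | zero =>
    intro M hM
    refine ⟨M, hM, fun u _ _ h0 _ => ?_⟩
    simpa using h0
  | succ k ih =>
    intro M hM
    obtain ⟨B, hB, H⟩ := ih M hM
    let C := lintegralPowLePowLIntegralFDerivConst (volume : Measure (E 2)) 2
    refine ⟨C * (((k + 1 + 1 : ℕ) : ℝ≥0∞) * (B + M)) ^ (2 : ℝ), by finiteness,
      fun u hu hc h0 h1 => ?_⟩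
    have key := lintegral_pow_le_pow_lintegral_fderiv (volume : Measure (E 2)) (p := 2)
      (u := fun x => u x ^ (k + 1 + 1)) (hu.pow _) (hc.comp_left (g := fun z => z ^ (k + 1 + 1))
        (by simp)) (by
          simp only [finrank_euclideanSpace, Fintype.card_fin]
          exact_mod_cast (Real.HolderConjugate.two_two))
    calc ∫⁻ x, ‖u x‖ₑ ^ ((2 : ℝ) * ((k + 1 : ℕ) + 1))
        = ∫⁻ x, ‖u x ^ (k + 1 + 1)‖ₑ ^ (2 : ℝ) := by
          refine lintegral_congr fun x => ?_
          rw [enorm_pow, ← ENNReal.rpow_natCast, ← ENNReal.rpow_mul, mul_comm]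
          push_cast
          rfl
      _ ≤ _ := key
      _ ≤ _ := by
        gcongr
        calc ∫⁻ x, ‖fderiv ℝ (fun y => u y ^ (k + 1 + 1)) x‖ₑ
            ≤ ∫⁻ x, ((k + 1 + 1 : ℕ) : ℝ≥0∞) *
                (‖u x‖ₑ ^ ((2 : ℝ) * (k + 1)) + ‖fderiv ℝ u x‖ₑ ^ 2) := by
              refine lintegral_mono fun x => (enorm_fderiv_pow_le hu (k + 1) x).trans ?_
              gcongr
              refine (ENNReal_mul_le_sq_add_sq _ _).trans (le_of_eq ?_)
              congr 1
              rw [← pow_mul, ← ENNReal.rpow_natCast, mul_comm]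
              push_cast
              rfl
          _ = ((k + 1 + 1 : ℕ) : ℝ≥0∞) * ((∫⁻ x, ‖u x‖ₑ ^ ((2 : ℝ) * (k + 1))) +
                ∫⁻ x, ‖fderiv ℝ u x‖ₑ ^ 2) := by
              rw [lintegral_const_mul', lintegral_add_left]
              · exact hu.continuous.measurable.enorm.pow_const _
              · simp
          _ ≤ _ := by
              gcongr
              exact H u hu hc h0 h1

theorem isSobolevExponent_one {q : ℝ} (hq : 2 ≤ q) : IsSobolevExponent 1 q := by
  intro M hM
  refine ⟨(2 * (M + M)) ^ ((q - 2) / 2) * M, by finiteness, fun u hu hc h0 h1 => ?_⟩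
  let e : E 1 ≃ᵐ ℝ := (MeasurableEquiv.toLp 2 (Fin 1 → ℝ)).symm.trans
    (MeasurableEquiv.funUnique (Fin 1) ℝ)
  have he : MeasurePreserving e volume volume :=
    (volume_preserving_funUnique (Fin 1) ℝ).comp
      (EuclideanSpace.volume_preserving_symm_measurableEquiv_toLp (Fin 1))
  let L : ℝ →L[ℝ] E 1 := ContinuousLinearMap.toSpanSingleton ℝ (EuclideanSpace.single 0 1)
  have heL : ∀ t, e (L t) = t := fun t => by
    simp [e, L, MeasurableEquiv.funUnique]
  have hLe : ∀ x, L (e x) = x := fun x => e.injective (heL _)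
  have hsup : ∀ x, ‖u x‖ₑ ^ 2 ≤ 2 * (M + M) := by
    intro x
    have hclosed : IsClosedEmbedding L := by
      refine (Isometry.of_dist_eq fun a b => ?_).isClosedEmbedding
      rw [dist_eq_norm, ← map_sub]
      simp [L, norm_smul, Real.dist_eq]
    have h := HasCompactSupport.enorm_le_lintegral_Ici_deriv (f := fun t => u (L t) ^ 2)
      ((hu.comp L.contDiff).pow 2)
      ((hc.comp_isClosedEmbedding hclosed).comp_left (g := fun z => z ^ 2) (by simp)) (e x)
    simp only [hLe] at h
    rw [← enorm_pow]
    refine h.trans ((setLIntegral_le_lintegral _ _).trans ?_)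
    calc ∫⁻ t, ‖deriv (fun t => u (L t) ^ 2) t‖ₑ
        ≤ ∫⁻ t, 2 * (‖u (L t)‖ₑ ^ 2 + ‖fderiv ℝ u (L t)‖ₑ ^ 2) := by
          refine lintegral_mono fun t => ?_
          have h2 : HasFDerivAt (fun y => u y ^ 2) _ (L t) :=
            ((hu.pow 2).differentiable one_ne_zero (L t)).hasFDerivAt
          have h3 := h2.comp_hasDerivAt t L.hasDerivAt
          have h4 : deriv (fun t => u (L t) ^ 2) t = _ := h3.deriv
          have h5 : L 1 = EuclideanSpace.single 0 1 := by simp [L]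
          rw [h4]
          calc _ ≤ ‖fderiv ℝ (fun y => u y ^ 2) (L t)‖ₑ * ‖L 1‖ₑ :=
                ContinuousLinearMap.le_opENorm _ _
            _ = ‖fderiv ℝ (fun y => u y ^ 2) (L t)‖ₑ := by
                rw [h5, ← ofReal_norm (EuclideanSpace.single (0 : Fin 1) (1 : ℝ))]; simp
            _ ≤ _ := enorm_fderiv_pow_le hu 1 (L t)
            _ ≤ _ := by
                rw [pow_one]
                gcongr
                · norm_num
                · exact ENNReal_mul_le_sq_add_sq _ _
      _ = ∫⁻ x, 2 * (‖u x‖ₑ ^ 2 + ‖fderiv ℝ u x‖ₑ ^ 2) := by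
          rw [← he.lintegral_comp_emb e.measurableEmbedding]
          simp only [hLe]
      _ = 2 * ((∫⁻ x, ‖u x‖ₑ ^ 2) + ∫⁻ x, ‖fderiv ℝ u x‖ₑ ^ 2) := by
          rw [lintegral_const_mul' _ _ (by simp), lintegral_add_left]
          exact hu.continuous.measurable.enorm.pow_const _
      _ ≤ _ := by gcongr
  calc ∫⁻ x, ‖u x‖ₑ ^ q ≤ ∫⁻ x, (2 * (M + M)) ^ ((q - 2) / 2) * ‖u x‖ₑ ^ 2 := by
        refine lintegral_mono fun x => ?_
        have : ‖u x‖ₑ ^ q = (‖u x‖ₑ ^ 2) ^ ((q - 2) / 2) * ‖u x‖ₑ ^ 2 := by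
          rw [← ENNReal.rpow_two, ← ENNReal.rpow_mul, ← ENNReal.rpow_add_of_nonneg _ _
            (by linarith) (by norm_num)]
          congr 1
          ring
        rw [this]
        exact mul_le_mul_left (ENNReal.rpow_le_rpow (hsup x) (by linarith)) _
    _ = (2 * (M + M)) ^ ((q - 2) / 2) * ∫⁻ x, ‖u x‖ₑ ^ 2 := by
        rw [lintegral_const_mul' _ _ (by
          exact ENNReal.rpow_ne_top_of_nonneg (by linarith) (by finiteness))]
    _ ≤ _ := by gcongr

theorem isSobolevExponent_of_le_critExp {N : ℕ} (hN : 1 ≤ N) {q : ℝ} (hq : 2 ≤ q)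
    (hqc : ENNReal.ofReal q ≤ critExp N) : IsSobolevExponent N q := by
  rcases le_or_gt N 2 with h | h
  · interval_cases N
    · exact isSobolevExponent_one hq
    · obtain ⟨k, hk⟩ := exists_nat_ge q
      exact (isSobolevExponent_two k).interpolate hq (by
        have : (0 : ℝ) ≤ k := k.cast_nonneg
        linarith)
  · refine (isSobolevExponent_of_three_le h).interpolate hq ?_
    rw [critExp, if_neg (by omega)] at hqc
    have hN' : (3 : ℝ) ≤ N := by exact_mod_cast h
    exact (ENNReal.ofReal_le_ofReal_iff (div_nonneg (by linarith) (by linarith))).1 hqc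

open scoped Convolution

theorem sq_lintegral_le_lintegral_sq {α : Type*} [MeasurableSpace α] (ν : Measure α)
    [IsProbabilityMeasure ν] {h : α → ℝ≥0∞} (hh : AEMeasurable h ν) :
    (∫⁻ y, h y ∂ν) ^ 2 ≤ ∫⁻ y, h y ^ 2 ∂ν := by
  have key := ENNReal.lintegral_mul_le_Lp_mul_Lq ν Real.HolderConjugate.two_two hh
    (aemeasurable_const (b := (1 : ℝ≥0∞)))
  simp only [Pi.mul_apply, mul_one, ENNReal.one_rpow, lintegral_const, measure_univ] at key
  calc (∫⁻ y, h y ∂ν) ^ 2 ≤ ((∫⁻ y, h y ^ (2 : ℝ) ∂ν) ^ (1 / 2 : ℝ)) ^ 2 := by gcongr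
    _ = ∫⁻ y, h y ^ 2 ∂ν := by
      rw [← ENNReal.rpow_two, ← ENNReal.rpow_mul]
      simp

theorem lintegral_sq_lintegral_le {α β : Type*} [MeasurableSpace α] [MeasurableSpace β]
    (μ : Measure α) [SFinite μ] (ν : Measure β) [IsProbabilityMeasure ν] {Φ : α → β → ℝ≥0∞}
    (hΦ : Measurable (Function.uncurry Φ)) :
    ∫⁻ x, (∫⁻ y, Φ x y ∂ν) ^ 2 ∂μ ≤ ∫⁻ y, ∫⁻ x, Φ x y ^ 2 ∂μ ∂ν := by
  rw [lintegral_lintegral_swap (f := fun y x => Φ x y ^ 2)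
    ((hΦ.comp measurable_swap).pow_const 2).aemeasurable]
  exact lintegral_mono fun x => sq_lintegral_le_lintegral_sq ν
    (hΦ.comp measurable_prodMk_left).aemeasurable

/-- The probability measure with density a normalised bump function. -/
noncomputable def bumpMeasure {N : ℕ} (φ : ContDiffBump (0 : E N)) : Measure (E N) :=
  volume.withDensity fun y => ‖φ.normed volume y‖ₑ

theorem measurable_normed {N : ℕ} (φ : ContDiffBump (0 : E N)) :
    Measurable fun y => ‖φ.normed volume y‖ₑ :=
  φ.continuous_normed.measurable.enorm

instance {N : ℕ} (φ : ContDiffBump (0 : E N)) : IsProbabilityMeasure (bumpMeasure φ) := by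
  constructor
  rw [bumpMeasure, withDensity_apply _ MeasurableSet.univ, Measure.restrict_univ,
    ← ofReal_integral_norm_eq_lintegral_enorm φ.integrable_normed]
  simp [abs_of_nonneg (φ.nonneg_normed _), φ.integral_normed]

/-- Convolution with a normalised bump function. -/
noncomputable abbrev mollify {N : ℕ} {F : Type*} [NormedAddCommGroup F] [NormedSpace ℝ F]
    (φ : ContDiffBump (0 : E N)) (u : E N → F) : E N → F :=
  φ.normed volume ⋆[ContinuousLinearMap.lsmul ℝ ℝ, volume] u

theorem enorm_mollify_le {N : ℕ} {F : Type*} [NormedAddCommGroup F] [NormedSpace ℝ F]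
    (φ : ContDiffBump (0 : E N)) {u : E N → F} (hu : StronglyMeasurable u) (x : E N) :
    ‖mollify φ u x‖ₑ ≤ ∫⁻ y, ‖u (x - y)‖ₑ ∂(bumpMeasure φ) := by
  have hm : Measurable fun y => ‖u (x - y)‖ₑ :=
    hu.enorm.comp (measurable_const.sub measurable_id)
  rw [bumpMeasure, lintegral_withDensity_eq_lintegral_mul _ (measurable_normed φ) hm]
  refine (enorm_integral_le_lintegral_enorm _).trans (le_of_eq ?_)
  simp only [ContinuousLinearMap.lsmul_apply, enorm_smul, Pi.mul_apply]

theorem measurable_uncurry_sub {N : ℕ} {F : Type*} [NormedAddCommGroup F]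
    {u : E N → F} (hu : StronglyMeasurable u) :
    Measurable (Function.uncurry fun x y : E N => ‖u (x - y)‖ₑ) :=
  hu.enorm.comp (measurable_fst.sub measurable_snd)

theorem lintegral_lintegral_sub_sq_le {N : ℕ} {F : Type*} [NormedAddCommGroup F]
    (φ : ContDiffBump (0 : E N)) {u : E N → F} (hu : StronglyMeasurable u) :
    ∫⁻ x, (∫⁻ y, ‖u (x - y)‖ₑ ∂(bumpMeasure φ)) ^ 2 ≤ ∫⁻ x, ‖u x‖ₑ ^ 2 := by
  refine (lintegral_sq_lintegral_le _ _ (measurable_uncurry_sub hu)).trans (le_of_eq ?_)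
  have h : ∀ y : E N, ∫⁻ x, ‖u (x - y)‖ₑ ^ 2 = ∫⁻ x, ‖u x‖ₑ ^ 2 := fun y =>
    lintegral_sub_right_eq_self (fun x => ‖u x‖ₑ ^ 2) y
  simp [h]

theorem lintegral_mollify_sq_le {N : ℕ} {F : Type*} [NormedAddCommGroup F] [NormedSpace ℝ F]
    (φ : ContDiffBump (0 : E N)) {u : E N → F} (hu : StronglyMeasurable u) :
    ∫⁻ x, ‖mollify φ u x‖ₑ ^ 2 ≤ ∫⁻ x, ‖u x‖ₑ ^ 2 := by
  refine le_trans (lintegral_mono fun x => ?_) (lintegral_lintegral_sub_sq_le φ hu)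
  have := enorm_mollify_le φ hu x
  gcongr

theorem contDiff_mollify {N : ℕ} (φ : ContDiffBump (0 : E N)) {u : E N → ℂ}
    (hu : LocallyIntegrable u) : ContDiff ℝ 1 (mollify φ u) :=
  φ.hasCompactSupport_normed.contDiff_convolution_left _ (φ.contDiff_normed (n := 1)) hu

theorem fderiv_mollify_single {N : ℕ} (φ : ContDiffBump (0 : E N)) {u : E N → ℂ}
    {G : E N → EuclideanSpace ℂ (Fin N)} (hu : LocallyIntegrable u)
    (h : IsWeakGradient u G) (x : E N) (i : Fin N) :
    fderiv ℝ (mollify φ u) x (EuclideanSpace.single i 1) = mollify φ (fun y => G y i) x := by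
  have hφ : ContDiff ℝ ∞ (φ.normed volume) := φ.contDiff_normed
  have hd := φ.hasCompactSupport_normed (μ := volume).hasFDerivAt_convolution_left
    (ContinuousLinearMap.lsmul ℝ ℝ : ℝ →L[ℝ] ℂ →L[ℝ] ℂ) (hφ.of_le (by simp)) hu x
  rw [hd.fderiv]
  have hc : HasCompactSupport (fderiv ℝ (φ.normed (volume : Measure (E N)))) :=
    φ.hasCompactSupport_normed.fderiv ℝ
  have hce := hc.convolutionExists_left (ContinuousLinearMap.precompL (E N)
    (ContinuousLinearMap.lsmul ℝ ℝ : ℝ →L[ℝ] ℂ →L[ℝ] ℂ)) (hφ.continuous_fderiv (by simp)) hu x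
  have hpl : (fderiv ℝ (φ.normed volume) ⋆[ContinuousLinearMap.precompL (E N)
      (ContinuousLinearMap.lsmul ℝ ℝ), volume] u) x (EuclideanSpace.single i 1) =
      ((fun a => fderiv ℝ (φ.normed volume) a (EuclideanSpace.single i 1))
        ⋆[ContinuousLinearMap.lsmul ℝ ℝ, volume] u) x := by
    simp_rw [convolution_def, ContinuousLinearMap.integral_apply hce]
    rfl
  rw [hpl]
  have ht : ContDiff ℝ ∞ fun y => φ.normed (volume : Measure (E N)) (x - y) :=
    hφ.comp (contDiff_const.sub contDiff_id)
  have htc : HasCompactSupport fun y => φ.normed (volume : Measure (E N)) (x - y) :=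
    φ.hasCompactSupport_normed.comp_homeomorph (Homeomorph.subLeft x)
  have key := h _ ht htc i
  have hfd : ∀ y, fderiv ℝ (fun y => φ.normed (volume : Measure (E N)) (x - y)) y
      (EuclideanSpace.single i 1) =
      - fderiv ℝ (φ.normed (volume : Measure (E N))) (x - y) (EuclideanSpace.single i 1) := by
    intro y
    have h1 : HasFDerivAt (fun y => x - y) (-(ContinuousLinearMap.id ℝ (E N))) y :=
      (hasFDerivAt_id y).const_sub x
    have h2 : HasFDerivAt (fun y => φ.normed (volume : Measure (E N)) (x - y)) _ y :=
      ((hφ.differentiable (by simp) (x - y)).hasFDerivAt).comp y h1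
    rw [h2.fderiv]
    simp
  simp only [hfd, neg_smul, integral_neg, neg_inj] at key
  rw [convolution_lsmul_swap, mollify, convolution_lsmul_swap]
  exact key

theorem enorm_clm_le_sum {N : ℕ} (L : E N →L[ℝ] ℂ) :
    ‖L‖ₑ ≤ ∑ i, ‖L (EuclideanSpace.single i 1)‖ₑ := by
  simp only [← ofReal_norm]
  rw [← ENNReal.ofReal_sum_of_nonneg fun _ _ => norm_nonneg _]
  refine ENNReal.ofReal_le_ofReal (L.opNorm_le_bound (Finset.sum_nonneg fun _ _ => norm_nonneg _)
    fun v => ?_)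
  have hv : v = ∑ i, v i • EuclideanSpace.single i (1 : ℝ) := by
    ext j
    simp [Pi.single_apply]
  conv_lhs => rw [hv, map_sum]
  rw [Finset.sum_mul]
  refine (norm_sum_le _ _).trans (Finset.sum_le_sum fun i _ => ?_)
  rw [map_smul, norm_smul, mul_comm]
  gcongr
  exact PiLp.norm_apply_le v i

theorem enorm_fderiv_mollify_le {N : ℕ} (φ : ContDiffBump (0 : E N)) {u : E N → ℂ}
    {G : E N → EuclideanSpace ℂ (Fin N)} (hu : LocallyIntegrable u) (hG : StronglyMeasurable G)
    (h : IsWeakGradient u G) (x : E N) :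
    ‖fderiv ℝ (mollify φ u) x‖ₑ ≤ N * ∫⁻ y, ‖G (x - y)‖ₑ ∂(bumpMeasure φ) := by
  refine (enorm_clm_le_sum _).trans ?_
  calc ∑ i, ‖fderiv ℝ (mollify φ u) x (EuclideanSpace.single i 1)‖ₑ
      ≤ ∑ _i : Fin N, ∫⁻ y, ‖G (x - y)‖ₑ ∂(bumpMeasure φ) := by
        refine Finset.sum_le_sum fun i _ => ?_
        rw [fderiv_mollify_single φ hu h]
        refine (enorm_mollify_le φ
          ((EuclideanSpace.proj (𝕜 := ℂ) i).continuous.comp_stronglyMeasurable hG) x).trans ?_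
        refine lintegral_mono fun y => ?_
        rw [← ofReal_norm, ← ofReal_norm]
        exact ENNReal.ofReal_le_ofReal (PiLp.norm_apply_le _ i)
    _ = _ := by simp

theorem lintegral_fderiv_mollify_sq_le {N : ℕ} (φ : ContDiffBump (0 : E N)) {u : E N → ℂ}
    {G : E N → EuclideanSpace ℂ (Fin N)} (hu : LocallyIntegrable u) (hG : StronglyMeasurable G)
    (h : IsWeakGradient u G) :
    ∫⁻ x, ‖fderiv ℝ (mollify φ u) x‖ₑ ^ 2 ≤ N ^ 2 * ∫⁻ x, ‖G x‖ₑ ^ 2 := by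
  calc ∫⁻ x, ‖fderiv ℝ (mollify φ u) x‖ₑ ^ 2
      ≤ ∫⁻ x, (N : ℝ≥0∞) ^ 2 * (∫⁻ y, ‖G (x - y)‖ₑ ∂(bumpMeasure φ)) ^ 2 := by
        refine lintegral_mono fun x => ?_
        rw [← mul_pow]
        have := enorm_fderiv_mollify_le φ hu hG h x
        gcongr
    _ = (N : ℝ≥0∞) ^ 2 * ∫⁻ x, (∫⁻ y, ‖G (x - y)‖ₑ ∂(bumpMeasure φ)) ^ 2 :=
        lintegral_const_mul' _ _ (by finiteness)
    _ ≤ _ := by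
        exact mul_le_mul_right (lintegral_lintegral_sub_sq_le φ hG) _

theorem lintegral_translate_sub_sq_le {N : ℕ} {v : E N → ℂ} (hv : ContDiff ℝ 1 v) (y : E N) :
    ∫⁻ x, ‖v (x - y) - v x‖ₑ ^ 2 ≤ ‖y‖ₑ ^ 2 * ∫⁻ x, ‖fderiv ℝ v x‖ₑ ^ 2 := by
  let ν : Measure ℝ := volume.restrict (Set.Icc 0 1)
  have hν : IsProbabilityMeasure ν := ⟨by simp [ν]⟩
  have hmeas : Measurable (Function.uncurry fun (x : E N) (t : ℝ) =>
      ‖y‖ₑ * ‖fderiv ℝ v (x - t • y)‖ₑ) := by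
    have h1 : Continuous fun p : E N × ℝ => fderiv ℝ v (p.1 - p.2 • y) :=
      (hv.continuous_fderiv one_ne_zero).comp (by fun_prop)
    exact h1.measurable.enorm.const_mul _
  have hpt : ∀ x, ‖v (x - y) - v x‖ₑ ≤ ∫⁻ t, ‖y‖ₑ * ‖fderiv ℝ v (x - t • y)‖ₑ ∂ν := by
    intro x
    have hc : ContDiff ℝ 1 fun t : ℝ => v (x - t • y) := hv.comp (by fun_prop)
    have h := enorm_sub_le_lintegral_deriv_of_contDiffOn_Icc (hc.contDiffOn (s := Set.Icc 0 1))
      zero_le_one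
    simp only [one_smul, zero_smul, sub_zero] at h
    refine h.trans (lintegral_mono fun t => ?_)
    have h1 : HasDerivAt (fun t : ℝ => x - t • y) (-y) t := by
      simpa using ((hasDerivAt_id t).smul_const y).const_sub x
    have h2 : HasDerivAt (fun t : ℝ => v (x - t • y)) _ t :=
      ((hv.differentiable one_ne_zero (x - t • y)).hasFDerivAt).comp_hasDerivAt t h1
    rw [h2.deriv, mul_comm]
    refine (ContinuousLinearMap.le_opENorm _ _).trans (le_of_eq ?_)
    rw [enorm_neg]
  calc ∫⁻ x, ‖v (x - y) - v x‖ₑ ^ 2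
      ≤ ∫⁻ x, (∫⁻ t, ‖y‖ₑ * ‖fderiv ℝ v (x - t • y)‖ₑ ∂ν) ^ 2 := by
        refine lintegral_mono fun x => ?_
        have := hpt x
        gcongr
    _ ≤ ∫⁻ t, ∫⁻ x, (‖y‖ₑ * ‖fderiv ℝ v (x - t • y)‖ₑ) ^ 2 ∂volume ∂ν :=
        lintegral_sq_lintegral_le _ _ hmeas
    _ = ∫⁻ _t, ‖y‖ₑ ^ 2 * ∫⁻ x, ‖fderiv ℝ v x‖ₑ ^ 2 ∂volume ∂ν := by
        refine lintegral_congr fun t => ?_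
        simp only [mul_pow]
        rw [lintegral_const_mul' _ _ (by finiteness),
          lintegral_sub_right_eq_self (fun x => ‖fderiv ℝ v x‖ₑ ^ 2) (t • y)]
    _ = _ := by simp

/-- A sequence of bump functions whose supports shrink to the origin. -/
noncomputable def bumpSeq (N n : ℕ) : ContDiffBump (0 : E N) :=
  ⟨1 / (n + 1), 2 / (n + 1), by positivity, by gcongr; norm_num⟩

theorem tendsto_rOut_bumpSeq (N : ℕ) :
    Tendsto (fun n => (bumpSeq N n).rOut) atTop (𝓝 0) := by
  have := (tendsto_one_div_add_atTop_nhds_zero_nat (𝕜 := ℝ)).const_mul 2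
  simpa [bumpSeq, div_eq_mul_inv] using this

theorem ae_tendsto_mollify_bumpSeq {N : ℕ} {u : E N → ℂ} (hu : LocallyIntegrable u) :
    ∀ᵐ x, Tendsto (fun n => mollify (bumpSeq N n) u x) atTop (𝓝 (u x)) :=
  ContDiffBump.ae_convolution_tendsto_right_of_locallyIntegrable (K := 2)
    (tendsto_rOut_bumpSeq N) (Eventually.of_forall fun _ => (mul_one_div 2 _).ge) hu

theorem lintegral_translate_sub_sq_le_of_isWeakGradient {N : ℕ} {u : E N → ℂ}
    {G : E N → EuclideanSpace ℂ (Fin N)} (hu : LocallyIntegrable u) (hG : StronglyMeasurable G)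
    (h : IsWeakGradient u G) (y : E N) :
    ∫⁻ x, ‖u (x - y) - u x‖ₑ ^ 2 ≤ ‖y‖ₑ ^ 2 * (N ^ 2 * ∫⁻ x, ‖G x‖ₑ ^ 2) := by
  have h1 := ae_tendsto_mollify_bumpSeq hu
  have h2 : ∀ᵐ x, Tendsto (fun n => mollify (bumpSeq N n) u (x - y)) atTop (𝓝 (u (x - y))) :=
    (measurePreserving_sub_right volume y).quasiMeasurePreserving.ae h1
  have hc := fun n => contDiff_mollify (bumpSeq N n) hu
  calc ∫⁻ x, ‖u (x - y) - u x‖ₑ ^ 2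
      = ∫⁻ x, liminf (fun n => ‖mollify (bumpSeq N n) u (x - y) -
          mollify (bumpSeq N n) u x‖ₑ ^ 2) atTop := by
        refine lintegral_congr_ae ?_
        filter_upwards [h1, h2] with x h1 h2
        exact (((ENNReal.continuous_pow 2).tendsto _).comp ((h2.sub h1).enorm)).liminf_eq.symm
    _ ≤ liminf (fun n => ∫⁻ x, ‖mollify (bumpSeq N n) u (x - y) -
          mollify (bumpSeq N n) u x‖ₑ ^ 2) atTop := by
        refine lintegral_liminf_le fun n => ?_
        have : Continuous fun x => mollify (bumpSeq N n) u (x - y) - mollify (bumpSeq N n) u x :=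
          ((hc n).continuous.comp (by fun_prop)).sub (hc n).continuous
        exact this.measurable.enorm.pow_const 2
    _ ≤ liminf (fun _ : ℕ => ‖y‖ₑ ^ 2 * (N ^ 2 * ∫⁻ x, ‖G x‖ₑ ^ 2)) atTop := by
        refine liminf_le_liminf (Eventually.of_forall fun n => ?_)
        refine (lintegral_translate_sub_sq_le (hc n) y).trans ?_
        gcongr
        exact lintegral_fderiv_mollify_sq_le _ hu hG h
    _ = _ := liminf_const _

theorem lintegral_mollify_sub_sq_le {N : ℕ} (φ : ContDiffBump (0 : E N)) {u : E N → ℂ}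
    {G : E N → EuclideanSpace ℂ (Fin N)} (hum : StronglyMeasurable u)
    (hu : LocallyIntegrable u) (hG : StronglyMeasurable G) (h : IsWeakGradient u G) :
    ∫⁻ x, ‖mollify φ u x - u x‖ₑ ^ 2 ≤
      ENNReal.ofReal φ.rOut ^ 2 * (N ^ 2 * ∫⁻ x, ‖G x‖ₑ ^ 2) := by
  have hmeas : Measurable (Function.uncurry fun x y : E N => ‖u (x - y) - u x‖ₑ) := by
    have h1 : StronglyMeasurable fun p : E N × E N => u (p.1 - p.2) :=
      hum.comp_measurable (measurable_fst.sub measurable_snd)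
    have h2 : StronglyMeasurable fun p : E N × E N => u p.1 := hum.comp_measurable measurable_fst
    exact (h1.sub h2).enorm
  have hmeasx : ∀ x, Measurable fun y => ‖u (x - y) - u x‖ₑ := fun x =>
    ((hum.comp_measurable (measurable_const.sub measurable_id)).sub
      stronglyMeasurable_const).enorm
  have hpt : ∀ x, ‖mollify φ u x - u x‖ₑ ≤ ∫⁻ y, ‖u (x - y) - u x‖ₑ ∂(bumpMeasure φ) := by
    intro x
    have hi : Integrable (fun y => φ.normed volume y • u (x - y)) volume :=
      φ.hasCompactSupport_normed.convolutionExists_left (ContinuousLinearMap.lsmul ℝ ℝ)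
        φ.continuous_normed hu x
    have e : mollify φ u x - u x = ∫ y, φ.normed volume y • (u (x - y) - u x) := by
      simp only [smul_sub]
      rw [integral_sub hi (φ.integrable_normed.smul_const _), φ.integral_normed_smul]
      rfl
    rw [e, bumpMeasure, lintegral_withDensity_eq_lintegral_mul _ (measurable_normed φ)
      (hmeasx x)]
    refine (enorm_integral_le_lintegral_enorm _).trans (le_of_eq ?_)
    simp only [enorm_smul, Pi.mul_apply]
  calc ∫⁻ x, ‖mollify φ u x - u x‖ₑ ^ 2
      ≤ ∫⁻ x, (∫⁻ y, ‖u (x - y) - u x‖ₑ ∂(bumpMeasure φ)) ^ 2 := by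
        refine lintegral_mono fun x => ?_
        have := hpt x
        gcongr
    _ ≤ ∫⁻ y, ∫⁻ x, ‖u (x - y) - u x‖ₑ ^ 2 ∂volume ∂(bumpMeasure φ) :=
        lintegral_sq_lintegral_le _ _ hmeas
    _ ≤ ∫⁻ _y, ENNReal.ofReal φ.rOut ^ 2 * (N ^ 2 * ∫⁻ x, ‖G x‖ₑ ^ 2 ∂volume) ∂(bumpMeasure φ) := by
        refine lintegral_mono_ae ?_
        rw [bumpMeasure, ae_withDensity_iff (measurable_normed φ)]
        refine Eventually.of_forall fun y hy => ?_
        refine (lintegral_translate_sub_sq_le_of_isWeakGradient hu hG h y).trans ?_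
        have hy' : y ∈ Function.support (φ.normed volume) := fun h0 => hy (by simp [h0])
        rw [φ.support_normed_eq, mem_ball_zero_iff] at hy'
        gcongr
        rw [← ofReal_norm]
        exact ENNReal.ofReal_le_ofReal hy'.le
    _ = _ := by simp

/-- The weak gradient of an element of `H¹`. -/
noncomputable def grad {N : ℕ} (u : H1 N) : E N → EuclideanSpace ℂ (Fin N) := (u : L2Pair N).snd

theorem stronglyMeasurable_toFun {N : ℕ} (u : H1 N) : StronglyMeasurable (toFun u) :=
  Lp.stronglyMeasurable _

theorem stronglyMeasurable_grad {N : ℕ} (u : H1 N) : StronglyMeasurable (grad u) :=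
  Lp.stronglyMeasurable _

theorem isWeakGradient_toFun {N : ℕ} (u : H1 N) : IsWeakGradient (toFun u) (grad u) := u.2

theorem locallyIntegrable_toFun {N : ℕ} (u : H1 N) : LocallyIntegrable (toFun u) :=
  locallyIntegrable_fst (u : L2Pair N)

theorem toFun_add {N : ℕ} (u v : H1 N) : toFun (u + v) =ᵐ[volume] toFun u + toFun v :=
  Lp.coeFn_add _ _

theorem toFun_sub {N : ℕ} (u v : H1 N) : toFun (u - v) =ᵐ[volume] toFun u - toFun v :=
  Lp.coeFn_sub _ _

theorem toFun_smul {N : ℕ} (c : ℝ) (u : H1 N) : toFun (c • u) =ᵐ[volume] c • toFun u :=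
  Lp.coeFn_smul _ _

theorem lintegral_enorm_sq_Lp {α F : Type*} [MeasurableSpace α] {μ : Measure α}
    [NormedAddCommGroup F] (u : Lp F 2 μ) : ∫⁻ x, ‖u x‖ₑ ^ 2 ∂μ = ‖u‖ₑ ^ 2 := by
  rw [Lp.enorm_def, eLpNorm_eq_lintegral_rpow_enorm_toReal (by simp) (by simp),
    ← ENNReal.rpow_two, ← ENNReal.rpow_mul]
  simp

theorem lintegral_toFun_sq_le {N : ℕ} (u : H1 N) : ∫⁻ x, ‖toFun u x‖ₑ ^ 2 ≤ ‖u‖ₑ ^ 2 := by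
  refine (lintegral_enorm_sq_Lp (u : L2Pair N).fst).le.trans ?_
  gcongr
  rw [← ofReal_norm, ← ofReal_norm]
  refine ENNReal.ofReal_le_ofReal ?_
  refine abs_le_of_sq_le_sq' ?_ (norm_nonneg _) |>.2
  have h := WithLp.prod_norm_sq_eq_of_L2 (u : L2Pair N)
  have h2 : ‖u‖ = ‖(u : L2Pair N)‖ := rfl
  rw [h2, h]
  exact le_add_of_nonneg_right (sq_nonneg _)

theorem lintegral_grad_sq_le {N : ℕ} (u : H1 N) : ∫⁻ x, ‖grad u x‖ₑ ^ 2 ≤ ‖u‖ₑ ^ 2 := by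
  refine (lintegral_enorm_sq_Lp (u : L2Pair N).snd).le.trans ?_
  gcongr
  rw [← ofReal_norm, ← ofReal_norm]
  refine ENNReal.ofReal_le_ofReal ?_
  refine abs_le_of_sq_le_sq' ?_ (norm_nonneg _) |>.2
  have h := WithLp.prod_norm_sq_eq_of_L2 (u : L2Pair N)
  have h2 : ‖u‖ = ‖(u : L2Pair N)‖ := rfl
  rw [h2, h]
  exact le_add_of_nonneg_left (sq_nonneg _)

theorem ENNReal_add_sq_le (a b : ℝ≥0∞) : (a + b) ^ 2 ≤ 4 * (a ^ 2 + b ^ 2) := by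
  have h : ∀ c : ℝ≥0∞, (c + c) ^ 2 = 4 * c ^ 2 := fun c => by ring
  rcases le_total a b with hab | hab
  · calc (a + b) ^ 2 ≤ (b + b) ^ 2 := by gcongr
      _ = 4 * b ^ 2 := h b
      _ ≤ _ := by gcongr; exact le_add_self
  · calc (a + b) ^ 2 ≤ (a + a) ^ 2 := by gcongr
      _ = 4 * a ^ 2 := h a
      _ ≤ _ := by gcongr; exact le_self_add

/-- A fixed smooth cut-off function, equal to `1` on the unit ball. -/
noncomputable def cutoff (N : ℕ) : ContDiffBump (0 : E N) := ⟨1, 2, one_pos, one_lt_two⟩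

theorem exists_bound_fderiv_cutoff (N : ℕ) :
    ∃ K : NNReal, ∀ (n : ℕ) (x : E N),
      ‖fderiv ℝ (fun x => cutoff N ((n + 1 : ℝ)⁻¹ • x)) x‖ₑ ≤ K := by
  obtain ⟨K, hK⟩ := ((cutoff N).hasCompactSupport.fderiv ℝ).exists_bound_of_continuous
    (((cutoff N).contDiff (n := 1)).continuous_fderiv one_ne_zero)
  refine ⟨K.toNNReal, fun n x => ?_⟩
  rw [← ofReal_norm]
  refine ENNReal.ofReal_le_ofReal ?_
  rw [fderiv_comp_smul (f := cutoff N), norm_smul]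
  calc _ ≤ 1 * K := by
        refine mul_le_mul ?_ (hK _) (norm_nonneg _) zero_le_one
        rw [Real.norm_of_nonneg (by positivity)]
        exact inv_le_one_of_one_le₀ (by linarith [(n.cast_nonneg : (0 : ℝ) ≤ n)])
    _ = K := one_mul K

theorem exists_contDiff_approx (N : ℕ) :
    ∃ C : ℝ≥0∞, C ≠ ⊤ ∧ ∀ u : H1 N, ∃ v : ℕ → E N → ℂ,
      (∀ n, ContDiff ℝ 1 (v n) ∧ HasCompactSupport (v n) ∧
        ∫⁻ x, ‖v n x‖ₑ ^ 2 ≤ C * ‖u‖ₑ ^ 2 ∧ ∫⁻ x, ‖fderiv ℝ (v n) x‖ₑ ^ 2 ≤ C * ‖u‖ₑ ^ 2) ∧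
      ∀ᵐ x, Tendsto (fun n => v n x) atTop (𝓝 (toFun u x)) := by
  obtain ⟨K, hK⟩ := exists_bound_fderiv_cutoff N
  refine ⟨4 * (N ^ 2 + K ^ 2) + 1, by finiteness, fun u => ?_⟩
  let χ : ℕ → E N → ℝ := fun n x => cutoff N ((n + 1 : ℝ)⁻¹ • x)
  let m : ℕ → E N → ℂ := fun n => mollify (bumpSeq N n) (toFun u)
  have hχ : ∀ n, ContDiff ℝ 1 (χ n) := fun n =>
    (cutoff N).contDiff.comp (contDiff_const_smul _)
  have hχ1 : ∀ n x, ‖χ n x‖ₑ ≤ 1 := fun n x => by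
    rw [← ofReal_norm, Real.norm_of_nonneg (cutoff N).nonneg, ENNReal.ofReal_le_one]
    exact (cutoff N).le_one
  have hm : ∀ n, ContDiff ℝ 1 (m n) := fun n => contDiff_mollify _ (locallyIntegrable_toFun u)
  have hm0 : ∀ n, ∫⁻ x, ‖m n x‖ₑ ^ 2 ≤ ‖u‖ₑ ^ 2 := fun n =>
    (lintegral_mollify_sq_le _ (stronglyMeasurable_toFun u)).trans (lintegral_toFun_sq_le u)
  have hm1 : ∀ n, ∫⁻ x, ‖fderiv ℝ (m n) x‖ₑ ^ 2 ≤ N ^ 2 * ‖u‖ₑ ^ 2 := fun n =>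
    (lintegral_fderiv_mollify_sq_le _ (locallyIntegrable_toFun u) (stronglyMeasurable_grad u)
      (isWeakGradient_toFun u)).trans (mul_le_mul_right (lintegral_grad_sq_le u) _)
  refine ⟨fun n x => χ n x • m n x, fun n => ⟨(hχ n).smul (hm n), ?_, ?_, ?_⟩, ?_⟩
  · exact ((cutoff N).hasCompactSupport.comp_smul (by positivity)).smul_right
  · calc ∫⁻ x, ‖χ n x • m n x‖ₑ ^ 2 ≤ ∫⁻ x, ‖m n x‖ₑ ^ 2 := by
          refine lintegral_mono fun x => ?_
          have h : ‖χ n x • m n x‖ₑ ≤ ‖m n x‖ₑ := by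
            rw [enorm_smul]
            exact mul_le_of_le_one_left' (hχ1 n x)
          gcongr
      _ ≤ ‖u‖ₑ ^ 2 := hm0 n
      _ ≤ _ := by
          rw [add_mul, one_mul]
          exact le_add_self
  · calc ∫⁻ x, ‖fderiv ℝ (fun x => χ n x • m n x) x‖ₑ ^ 2
        ≤ ∫⁻ x, 4 * (‖fderiv ℝ (m n) x‖ₑ ^ 2 + (K : ℝ≥0∞) ^ 2 * ‖m n x‖ₑ ^ 2) := by
          refine lintegral_mono fun x => ?_
          have h : ‖fderiv ℝ (fun x => χ n x • m n x) x‖ₑ ≤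
              ‖fderiv ℝ (m n) x‖ₑ + K * ‖m n x‖ₑ := by
            rw [fderiv_fun_smul ((hχ n).differentiable one_ne_zero x)
              ((hm n).differentiable one_ne_zero x)]
            refine (enorm_add_le (E := E N →L[ℝ] ℂ) _ _).trans (add_le_add ?_ ?_)
            · rw [enorm_smul]
              exact mul_le_of_le_one_left' (hχ1 n x)
            · refine le_trans (le_of_eq ?_) (mul_le_mul_left (hK n x) _)
              simp only [← ofReal_norm, ContinuousLinearMap.norm_smulRight_apply]
              exact ENNReal.ofReal_mul (norm_nonneg _)
          calc _ ≤ (‖fderiv ℝ (m n) x‖ₑ + K * ‖m n x‖ₑ) ^ 2 := by gcongr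
            _ ≤ _ := ENNReal_add_sq_le _ _
            _ = _ := by rw [mul_pow]
      _ = 4 * ((∫⁻ x, ‖fderiv ℝ (m n) x‖ₑ ^ 2) + (K : ℝ≥0∞) ^ 2 * ∫⁻ x, ‖m n x‖ₑ ^ 2) := by
          rw [lintegral_const_mul' _ _ (by simp), lintegral_add_left, lintegral_const_mul']
          · finiteness
          · exact ((hm n).continuous_fderiv one_ne_zero).measurable.enorm.pow_const 2
      _ ≤ 4 * (N ^ 2 * ‖u‖ₑ ^ 2 + (K : ℝ≥0∞) ^ 2 * ‖u‖ₑ ^ 2) := by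
          have h0 := hm0 n
          have h1 := hm1 n
          gcongr
      _ ≤ _ := by
          rw [add_mul, one_mul, mul_assoc, add_mul]
          exact le_self_add
  · filter_upwards [ae_tendsto_mollify_bumpSeq (locallyIntegrable_toFun u)] with x hx
    have hone : ∀ᶠ n : ℕ in atTop, χ n x = 1 := by
      filter_upwards [eventually_ge_atTop ⌈‖x‖⌉₊] with n hn
      refine (cutoff N).one_of_mem_closedBall ?_
      rw [mem_closedBall_zero_iff, norm_smul, Real.norm_of_nonneg (by positivity)]
      have h1 : ‖x‖ ≤ n := (Nat.le_ceil _).trans (by exact_mod_cast hn)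
      change (n + 1 : ℝ)⁻¹ * ‖x‖ ≤ 1
      rw [inv_mul_le_iff₀ (by positivity)]
      linarith
    refine hx.congr' ?_
    filter_upwards [hone] with n hn
    rw [hn, one_smul]

/-- The Sobolev embedding `H¹ ⊂ L^q`. -/
theorem exists_lintegral_rpow_le {N : ℕ} (hN : 1 ≤ N) {q : ℝ} (hq : 2 ≤ q)
    (hqc : ENNReal.ofReal q ≤ critExp N) :
    ∃ B : ℝ≥0∞, B ≠ ⊤ ∧ ∀ u : H1 N, ∫⁻ x, ‖toFun u x‖ₑ ^ q ≤ B * ‖u‖ₑ ^ q := by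
  obtain ⟨C, hC, hv⟩ := exists_contDiff_approx N
  obtain ⟨B, hB, H⟩ := isSobolevExponent_of_le_critExp hN hq hqc C hC
  have hq0 : 0 < q := by linarith
  have unit : ∀ u : H1 N, ‖u‖ₑ ≤ 1 → ∫⁻ x, ‖toFun u x‖ₑ ^ q ≤ B := by
    intro u hu
    obtain ⟨v, h1, h2⟩ := hv u
    have hCu : C * ‖u‖ₑ ^ 2 ≤ C := mul_le_of_le_one_right' (pow_le_one' hu 2)
    calc ∫⁻ x, ‖toFun u x‖ₑ ^ q = ∫⁻ x, liminf (fun n => ‖v n x‖ₑ ^ q) atTop := by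
          refine lintegral_congr_ae ?_
          filter_upwards [h2] with x hx
          exact ((ENNReal.continuous_rpow_const.tendsto _).comp hx.enorm).liminf_eq.symm
      _ ≤ liminf (fun n => ∫⁻ x, ‖v n x‖ₑ ^ q) atTop :=
          lintegral_liminf_le fun n => (h1 n).1.continuous.measurable.enorm.pow_const q
      _ ≤ liminf (fun _ : ℕ => B) atTop :=
          liminf_le_liminf (Eventually.of_forall fun n => H _ (h1 n).1 (h1 n).2.1
            ((h1 n).2.2.1.trans hCu) ((h1 n).2.2.2.trans hCu))
      _ = B := liminf_const _
  refine ⟨B, hB, fun u => ?_⟩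
  rcases eq_or_ne u 0 with rfl | hu
  · have h0 : toFun (0 : H1 N) =ᵐ[volume] 0 := Lp.coeFn_zero ..
    rw [lintegral_congr_ae (g := fun _ => 0)]
    · simp
    · filter_upwards [h0] with x hx
      simp [hx, hq0]
  · have hn : ‖u‖ ≠ 0 := norm_ne_zero_iff.2 hu
    set w : H1 N := ‖u‖⁻¹ • u with hw
    have huw : u = ‖u‖ • w := by rw [hw, smul_smul, mul_inv_cancel₀ hn, one_smul]
    have hw1 : ‖w‖ₑ ≤ 1 := by
      rw [← ofReal_norm, hw, norm_smul, norm_inv, norm_norm, inv_mul_cancel₀ hn]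
      simp
    have e : toFun u =ᵐ[volume] ‖u‖ • toFun w := by
      conv_lhs => rw [huw]
      exact toFun_smul _ _
    calc ∫⁻ x, ‖toFun u x‖ₑ ^ q = ∫⁻ x, ‖u‖ₑ ^ q * ‖toFun w x‖ₑ ^ q := by
          refine lintegral_congr_ae ?_
          filter_upwards [e] with x hx
          rw [hx, Pi.smul_apply, enorm_smul, enorm_norm, ENNReal.mul_rpow_of_nonneg _ _ hq0.le]
      _ = ‖u‖ₑ ^ q * ∫⁻ x, ‖toFun w x‖ₑ ^ q := lintegral_const_mul' _ _ (by finiteness)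
      _ ≤ ‖u‖ₑ ^ q * B := mul_le_mul_right (unit w hw1) _
      _ = _ := mul_comm _ _

/-- Integration of `L²` functions against a continuous function with compact support. -/
theorem exists_clm_integral_smul {N : ℕ} {F : Type*} [NormedAddCommGroup F] [NormedSpace ℝ F]
    [CompleteSpace F] {ψ : E N → ℝ} (hψ : Continuous ψ) (hc : HasCompactSupport ψ) :
    ∃ T : Lp F 2 (volume : Measure (E N)) →L[ℝ] F, ∀ u, T u = ∫ x, ψ x • u x := by
  have hm : MemLp ψ 2 (volume : Measure (E N)) := hψ.memLp_of_hasCompactSupport hc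
  refine ⟨(ContinuousLinearMap.lsmul ℝ ℝ).lpPairing volume 2 2 (hm.toLp ψ), fun u => ?_⟩
  rw [ContinuousLinearMap.lpPairing_eq_integral]
  refine integral_congr_ae ?_
  filter_upwards [hm.coeFn_toLp] with x hx
  simp [hx]

theorem isClosed_H1 (N : ℕ) : IsClosed (H1 N : Set (L2Pair N)) := by
  have hset : (H1 N : Set (L2Pair N)) = ⋂ (φ : E N → ℝ) (_ : ContDiff ℝ ∞ φ)
      (_ : HasCompactSupport φ) (i : Fin N), {w : L2Pair N |
        ∫ x, (fderiv ℝ φ x (EuclideanSpace.single i 1)) • (w.fst : E N → ℂ) x =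
          - ∫ x, φ x • (w.snd : E N → EuclideanSpace ℂ (Fin N)) x i} := by
    ext w
    simp only [Set.mem_iInter, Set.mem_ofPred_eq]
    rfl
  rw [hset]
  refine isClosed_iInter fun φ => isClosed_iInter fun hφ => isClosed_iInter fun hc =>
    isClosed_iInter fun i => ?_
  obtain ⟨T, hT⟩ := exists_clm_integral_smul (F := ℂ) (continuous_partial hφ i)
    (hasCompactSupport_partial hc i)
  obtain ⟨S, hS⟩ := exists_clm_integral_smul (F := EuclideanSpace ℂ (Fin N)) hφ.continuous hc
  have hS' : ∀ w : L2Pair N, ∫ x, φ x • (w.snd : E N → EuclideanSpace ℂ (Fin N)) x i =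
      S w.snd i := by
    intro w
    rw [hS]
    have hi : Integrable (fun x => φ x • (w.snd : E N → EuclideanSpace ℂ (Fin N)) x) :=
      ((Lp.memLp w.snd).locallyIntegrable (by norm_num)).integrable_smul_left_of_hasCompactSupport
        hφ.continuous hc
    exact (EuclideanSpace.proj (𝕜 := ℂ) i).integral_comp_comm hi
  simp only [← hT, hS']
  exact isClosed_eq (by fun_prop) (by fun_prop)

instance (N : ℕ) : CompleteSpace (H1 N) := (isClosed_H1 N).completeSpace_coe

theorem tendsto_apply_of_tendsto_toWeakSpace {V : Type*} [NormedAddCommGroup V] [NormedSpace ℝ V]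
    {u : ℕ → V} {u₀ : V}
    (h : Tendsto (fun n => toWeakSpace ℝ V (u n)) atTop (𝓝 (toWeakSpace ℝ V u₀)))
    (ℓ : StrongDual ℝ V) : Tendsto (fun n => ℓ (u n)) atTop (𝓝 (ℓ u₀)) :=
  ((WeakBilin.eval_continuous (topDualPairing ℝ V).flip ℓ).tendsto _).comp h

theorem tendsto_toWeakSpace_of_forall {V : Type*} [NormedAddCommGroup V] [NormedSpace ℝ V]
    {u : ℕ → V} {u₀ : V} (h : ∀ ℓ : StrongDual ℝ V, Tendsto (fun n => ℓ (u n)) atTop (𝓝 (ℓ u₀))) :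
    Tendsto (fun n => toWeakSpace ℝ V (u n)) atTop (𝓝 (toWeakSpace ℝ V u₀)) := by
  refine (WeakBilin.tendsto_iff_forall_eval_tendsto (topDualPairing ℝ V).flip ?_).2 h
  exact fun x y hxy => (SeparatingDual.eq_iff_forall_dual_eq (R := ℝ)).2 fun ℓ => DFunLike.congr_fun hxy ℓ

theorem exists_norm_le_of_tendsto_toWeakSpace {V : Type*} [NormedAddCommGroup V] [NormedSpace ℝ V]
    {u : ℕ → V} {u₀ : V}
    (h : Tendsto (fun n => toWeakSpace ℝ V (u n)) atTop (𝓝 (toWeakSpace ℝ V u₀))) :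
    ∃ M : ℝ, ∀ n, ‖u n‖ ≤ M := by
  obtain ⟨M, hM⟩ := banach_steinhaus
    (g := fun n => (NormedSpace.inclusionInDoubleDual ℝ V (u n) : StrongDual ℝ V →L[ℝ] ℝ))
    (fun ℓ => by
      obtain ⟨C, hC⟩ := (tendsto_apply_of_tendsto_toWeakSpace h ℓ).norm.bddAbove_range
      exact ⟨C, fun n => hC ⟨n, rfl⟩⟩)
  refine ⟨M, fun n => ?_⟩
  rw [← (NormedSpace.inclusionInDoubleDualLi ℝ (E := V)).norm_map (u n)]
  exact hM n

theorem exists_forall_bidual_eq {V : Type*} [NormedAddCommGroup V] [InnerProductSpace ℝ V]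
    [CompleteSpace V] (Λ : StrongDual ℝ (StrongDual ℝ V)) :
    ∃ w : V, ∀ T : StrongDual ℝ V, Λ T = T w := by
  let D := InnerProductSpace.toDual ℝ V
  let ℓ : StrongDual ℝ V := LinearMap.mkContinuous
    { toFun := fun v => Λ (D v)
      map_add' := fun v w => by rw [map_add, map_add]
      map_smul' := fun c v => by simp [D] } ‖Λ‖ fun v =>
        (Λ.le_opNorm (D v)).trans_eq (by rw [LinearIsometryEquiv.norm_map])
  refine ⟨D.symm ℓ, fun T => ?_⟩
  have h1 : Λ T = ℓ (D.symm T) := by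
    change Λ T = Λ (D (D.symm T))
    rw [LinearIsometryEquiv.apply_symm_apply]
  rw [h1, ← InnerProductSpace.toDual_symm_apply, real_inner_comm,
    InnerProductSpace.toDual_symm_apply]

/-- Weak convergence in the dual of a Hilbert space is convergence at every point. -/
theorem tendsto_toWeakSpace_dual {V : Type*} [NormedAddCommGroup V] [InnerProductSpace ℝ V]
    [CompleteSpace V] {G : ℕ → StrongDual ℝ V} {G₀ : StrongDual ℝ V}
    (h : ∀ v, Tendsto (fun n => G n v) atTop (𝓝 (G₀ v))) :
    Tendsto (fun n => toWeakSpace ℝ (StrongDual ℝ V) (G n)) atTop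
      (𝓝 (toWeakSpace ℝ (StrongDual ℝ V) G₀)) := by
  refine tendsto_toWeakSpace_of_forall (V := StrongDual ℝ V) fun Λ => ?_
  obtain ⟨w, hw⟩ := exists_forall_bidual_eq Λ
  simp only [hw]
  exact h w

theorem tendsto_toWeakSpace_Hneg1 {N : ℕ} {G : ℕ → Hneg1 N} {G₀ : Hneg1 N}
    (h : ∀ v, Tendsto (fun n => G n v) atTop (𝓝 (G₀ v))) :
    Tendsto (fun n => toWeakSpace ℝ (Hneg1 N) (G n)) atTop (𝓝 (toWeakSpace ℝ (Hneg1 N) G₀)) :=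
  tendsto_toWeakSpace_dual (V := H1 N) h

theorem exists_clm_mollify {N : ℕ} (φ : ContDiffBump (0 : E N)) (x : E N) :
    ∃ T : H1 N →L[ℝ] ℂ, ∀ u, T u = mollify φ (toFun u) x := by
  obtain ⟨T, hT⟩ := exists_clm_integral_smul (F := ℂ)
    (ψ := fun y => φ.normed (volume : Measure (E N)) (x - y))
    (φ.continuous_normed.comp (by fun_prop))
    (φ.hasCompactSupport_normed.comp_homeomorph (Homeomorph.subLeft x))
  refine ⟨T.comp ((WithLp.fstL 2 ℝ _ _).comp (H1 N).subtypeL), fun u => ?_⟩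
  rw [mollify, convolution_lsmul_swap]
  exact hT _

theorem exists_enorm_mollify_sq_le {N : ℕ} (φ : ContDiffBump (0 : E N)) :
    ∃ S : NNReal, ∀ (u : H1 N) (x : E N), ‖mollify φ (toFun u) x‖ₑ ^ 2 ≤ S * ‖u‖ₑ ^ 2 := by
  obtain ⟨K, hK⟩ := (φ.hasCompactSupport_normed (μ := volume)).exists_bound_of_continuous
    φ.continuous_normed
  refine ⟨K.toNNReal, fun u x => ?_⟩
  have hm : Measurable fun y => ‖toFun u (x - y)‖ₑ :=
    (stronglyMeasurable_toFun u).enorm.comp (measurable_const.sub measurable_id)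
  calc ‖mollify φ (toFun u) x‖ₑ ^ 2 ≤ (∫⁻ y, ‖toFun u (x - y)‖ₑ ∂(bumpMeasure φ)) ^ 2 := by
        have := enorm_mollify_le φ (stronglyMeasurable_toFun u) x
        gcongr
    _ ≤ ∫⁻ y, ‖toFun u (x - y)‖ₑ ^ 2 ∂(bumpMeasure φ) :=
        sq_lintegral_le_lintegral_sq _ hm.aemeasurable
    _ = ∫⁻ y, ‖φ.normed volume y‖ₑ * ‖toFun u (x - y)‖ₑ ^ 2 := by
        rw [bumpMeasure,
          lintegral_withDensity_eq_lintegral_mul _ (measurable_normed φ) (hm.pow_const 2)]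
        rfl
    _ ≤ ∫⁻ y, (K.toNNReal : ℝ≥0∞) * ‖toFun u (x - y)‖ₑ ^ 2 := by
        refine lintegral_mono fun y => mul_le_mul_left ?_ _
        rw [← ofReal_norm]
        exact ENNReal.ofReal_le_ofReal (hK y)
    _ = K.toNNReal * ∫⁻ y, ‖toFun u y‖ₑ ^ 2 := by
        rw [lintegral_const_mul' _ _ (by simp),
          lintegral_sub_left_eq_self (fun y => ‖toFun u y‖ₑ ^ 2) x]
    _ ≤ _ := mul_le_mul_right (lintegral_toFun_sq_le u) _

theorem exists_finite_measure_le (α : Type*) [MeasurableSpace α] (μ : Measure α) [SigmaFinite μ] :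
    ∃ ν : Measure α, IsFiniteMeasure ν ∧ ν ≤ μ ∧ μ ≪ ν := by
  obtain ⟨g, hg0, hgm, hg⟩ := exists_pos_lintegral_lt_of_sigmaFinite μ one_ne_zero
  have hmeas : Measurable fun x => min (g x : ℝ≥0∞) 1 := hgm.coe_nnreal_ennreal.min measurable_const
  refine ⟨μ.withDensity fun x => min (g x : ℝ≥0∞) 1, ?_, ?_, ?_⟩
  · refine isFiniteMeasure_withDensity (ne_top_of_lt (b := 1) ?_)
    exact (lintegral_mono fun x => min_le_left _ _).trans_lt hg
  · calc μ.withDensity (fun x => min (g x : ℝ≥0∞) 1) ≤ μ.withDensity 1 :=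
          withDensity_mono (Eventually.of_forall fun x => min_le_right _ _)
      _ = μ := withDensity_one
  · refine withDensity_absolutelyContinuous' hmeas.aemeasurable (Eventually.of_forall fun x => ?_)
    have : (0 : ℝ≥0∞) < g x := by exact_mod_cast hg0 x
    exact (lt_min this one_pos).ne'

theorem lintegral_sub_sq_le_three {α : Type*} [MeasurableSpace α] {ν : Measure α}
    {f g a b : α → ℂ} (m1 : Measurable fun x => ‖a x - f x‖ₑ ^ 2)
    (m2 : Measurable fun x => ‖a x - b x‖ₑ ^ 2) :
    ∫⁻ x, ‖f x - g x‖ₑ ^ 2 ∂ν ≤ 4 * (∫⁻ x, ‖a x - f x‖ₑ ^ 2 ∂ν) +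
      (16 * (∫⁻ x, ‖a x - b x‖ₑ ^ 2 ∂ν) + 16 * ∫⁻ x, ‖b x - g x‖ₑ ^ 2 ∂ν) := by
  rw [← lintegral_const_mul' _ _ (by simp), ← lintegral_const_mul' _ _ (by simp),
    ← lintegral_const_mul' _ _ (by simp), ← lintegral_add_left (m2.const_mul 16),
    ← lintegral_add_left (m1.const_mul 4)]
  refine lintegral_mono fun x => ?_
  have e : f x - g x = -(a x - f x) + ((a x - b x) + (b x - g x)) := by ring
  have h : ‖f x - g x‖ₑ ≤ ‖a x - f x‖ₑ + (‖a x - b x‖ₑ + ‖b x - g x‖ₑ) := by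
    rw [e]
    refine (enorm_add_le _ _).trans ?_
    rw [enorm_neg]
    gcongr
    exact enorm_add_le _ _
  calc ‖f x - g x‖ₑ ^ 2 ≤ (‖a x - f x‖ₑ + (‖a x - b x‖ₑ + ‖b x - g x‖ₑ)) ^ 2 := by gcongr
    _ ≤ 4 * (‖a x - f x‖ₑ ^ 2 + (‖a x - b x‖ₑ + ‖b x - g x‖ₑ) ^ 2) := ENNReal_add_sq_le _ _
    _ ≤ 4 * (‖a x - f x‖ₑ ^ 2 + 4 * (‖a x - b x‖ₑ ^ 2 + ‖b x - g x‖ₑ ^ 2)) := by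
        gcongr
        exact ENNReal_add_sq_le _ _
    _ = _ := by ring

/-- Local compactness of the embedding `H¹ ⊂ L²`, in the form of almost everywhere convergence. -/
theorem exists_subseq_ae_tendsto_of_weak {N : ℕ} {u : ℕ → H1 N} {u₀ : H1 N}
    (h : Tendsto (fun n => toWeakSpace ℝ (H1 N) (u n)) atTop (𝓝 (toWeakSpace ℝ (H1 N) u₀))) :
    ∃ ns : ℕ → ℕ, StrictMono ns ∧
      ∀ᵐ x, Tendsto (fun k => toFun (u (ns k)) x) atTop (𝓝 (toFun u₀ x)) := by
  obtain ⟨M₀, hM₀⟩ := exists_norm_le_of_tendsto_toWeakSpace h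
  obtain ⟨M, hMt, hM, hM'⟩ : ∃ M : ℝ≥0∞, M ≠ ⊤ ∧ (∀ n, ‖u n‖ₑ ^ 2 ≤ M) ∧ ‖u₀‖ₑ ^ 2 ≤ M := by
    refine ⟨ENNReal.ofReal M₀ ^ 2 + ‖u₀‖ₑ ^ 2, by finiteness, fun n => ?_, le_add_self⟩
    refine le_trans ?_ le_self_add
    gcongr
    rw [← ofReal_norm]
    exact ENNReal.ofReal_le_ofReal (hM₀ n)
  obtain ⟨ν, hνf, hνle, hνac⟩ := exists_finite_measure_le (E N) volume
  have hsm := stronglyMeasurable_toFun (N := N)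
  have hmoll : ∀ φ : ContDiffBump (0 : E N), ∀ v : H1 N, Measurable (mollify φ (toFun v)) :=
    fun φ v => (contDiff_mollify φ (locallyIntegrable_toFun v)).continuous.measurable
  have htail : ∀ k, ∀ v : H1 N, ‖v‖ₑ ^ 2 ≤ M →
      ∫⁻ x, ‖mollify (bumpSeq N k) (toFun v) x - toFun v x‖ₑ ^ 2 ∂ν ≤
        ENNReal.ofReal (bumpSeq N k).rOut ^ 2 * (N ^ 2 * M) := by
    intro k v hv
    refine (lintegral_mono' hνle le_rfl).trans
      ((lintegral_mollify_sub_sq_le _ (hsm v) (locallyIntegrable_toFun v)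
        (stronglyMeasurable_grad v) (isWeakGradient_toFun v)).trans ?_)
    have := (lintegral_grad_sq_le v).trans hv
    gcongr
  have hmid : ∀ k, Tendsto (fun n => ∫⁻ x, ‖mollify (bumpSeq N k) (toFun (u n)) x -
      mollify (bumpSeq N k) (toFun u₀) x‖ₑ ^ 2 ∂ν) atTop (𝓝 0) := by
    intro k
    obtain ⟨S, hS⟩ := exists_enorm_mollify_sq_le (bumpSeq N k)
    have hlim := tendsto_lintegral_of_dominated_convergence (μ := ν) (f := fun _ => 0)
      (F := fun n x => ‖mollify (bumpSeq N k) (toFun (u n)) x -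
        mollify (bumpSeq N k) (toFun u₀) x‖ₑ ^ 2) (fun _ => 4 * (S * M + S * M))
      (fun n => ((hmoll _ _).sub (hmoll _ _)).enorm.pow_const 2)
      (fun n => Eventually.of_forall fun x => by
        have h1 : ‖mollify (bumpSeq N k) (toFun (u n)) x -
            mollify (bumpSeq N k) (toFun u₀) x‖ₑ ≤ _ := enorm_sub_le
        exact (pow_le_pow_left₀ zero_le h1 2).trans ((ENNReal_add_sq_le _ _).trans
          (mul_le_mul_right (add_le_add ((hS _ _).trans (mul_le_mul_right (hM n) _))
            ((hS _ _).trans (mul_le_mul_right hM' _))) _)))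
      (by
        rw [lintegral_const]
        finiteness)
      (Eventually.of_forall fun x => by
        obtain ⟨T, hT⟩ := exists_clm_mollify (bumpSeq N k) x
        have hTw : Tendsto (fun n => T (u n)) atTop (𝓝 (T u₀)) := by
          have hre := tendsto_apply_of_tendsto_toWeakSpace h (Complex.reCLM.comp T)
          have him := tendsto_apply_of_tendsto_toWeakSpace h (Complex.imCLM.comp T)
          have := (Complex.continuous_ofReal.tendsto _).comp hre |>.add
            (((Complex.continuous_ofReal.tendsto _).comp him).mul_const Complex.I)
          simpa [Function.comp_def, Complex.re_add_im] using this
        simp only [hT] at hTw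
        have := (hTw.sub_const (mollify (bumpSeq N k) (toFun u₀) x)).enorm
        simpa [Function.comp_def] using (ENNReal.continuous_pow 2).tendsto _ |>.comp this)
    simpa using hlim
  have hconv : Tendsto (fun n => ∫⁻ x, ‖toFun (u n) x - toFun u₀ x‖ₑ ^ 2 ∂ν) atTop (𝓝 0) := by
    have hc : Tendsto (fun k => 20 * (ENNReal.ofReal (bumpSeq N k).rOut ^ 2 * (N ^ 2 * M))) atTop
        (𝓝 0) := by
      have h1 := (ENNReal.continuous_ofReal.tendsto 0).comp (tendsto_rOut_bumpSeq N)
      rw [ENNReal.ofReal_zero] at h1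
      have h2 := ((ENNReal.continuous_pow 2).tendsto 0).comp h1
      rw [zero_pow two_ne_zero] at h2
      have h3 := ENNReal.Tendsto.mul_const h2 (b := (N : ℝ≥0∞) ^ 2 * M) (Or.inr (by finiteness))
      have h4 := ENNReal.Tendsto.const_mul h3 (a := 20) (Or.inr (by simp))
      simpa using h4
    rw [ENNReal.tendsto_nhds_zero]
    intro ε hε
    obtain ⟨k, hk⟩ := ((ENNReal.tendsto_nhds_zero.1 hc) (ε / 2) (ENNReal.half_pos hε.ne')).exists
    have hmid' := ENNReal.Tendsto.const_mul (hmid k) (a := 16) (Or.inr (by simp))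
    rw [mul_zero] at hmid'
    filter_upwards [(ENNReal.tendsto_nhds_zero.1 hmid') (ε / 2) (ENNReal.half_pos hε.ne')]
      with n hn
    set φ := bumpSeq N k
    have m1 : Measurable fun x => ‖mollify φ (toFun (u n)) x - toFun (u n) x‖ₑ ^ 2 :=
      ((hmoll φ _).sub (hsm _).measurable).enorm.pow_const 2
    have m2 : Measurable fun x => ‖mollify φ (toFun (u n)) x - mollify φ (toFun u₀) x‖ₑ ^ 2 :=
      ((hmoll φ _).sub (hmoll φ _)).enorm.pow_const 2
    calc ∫⁻ x, ‖toFun (u n) x - toFun u₀ x‖ₑ ^ 2 ∂ν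
        ≤ 4 * (∫⁻ x, ‖mollify φ (toFun (u n)) x - toFun (u n) x‖ₑ ^ 2 ∂ν) +
            (16 * (∫⁻ x, ‖mollify φ (toFun (u n)) x - mollify φ (toFun u₀) x‖ₑ ^ 2 ∂ν) +
              16 * ∫⁻ x, ‖mollify φ (toFun u₀) x - toFun u₀ x‖ₑ ^ 2 ∂ν) :=
          lintegral_sub_sq_le_three m1 m2
      _ ≤ 4 * (ENNReal.ofReal φ.rOut ^ 2 * (N ^ 2 * M)) +
            (ε / 2 + 16 * (ENNReal.ofReal φ.rOut ^ 2 * (N ^ 2 * M))) := by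
          have t1 := htail k (u n) (hM n)
          have t2 := htail k u₀ hM'
          exact add_le_add (mul_le_mul_right t1 _) (add_le_add hn (mul_le_mul_right t2 _))
      _ = 20 * (ENNReal.ofReal φ.rOut ^ 2 * (N ^ 2 * M)) + ε / 2 := by ring
      _ ≤ ε / 2 + ε / 2 := by gcongr
      _ = ε := ENNReal.add_halves ε
  have hLp : Tendsto (fun n => eLpNorm (toFun (u n) - toFun u₀) 2 ν) atTop (𝓝 0) := by
    have := (ENNReal.continuous_rpow_const (y := (1 / 2 : ℝ))).tendsto 0 |>.comp hconv
    rw [ENNReal.zero_rpow_of_pos (by norm_num)] at this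
    refine this.congr fun n => ?_
    rw [eLpNorm_eq_lintegral_rpow_enorm_toReal (by simp) (by simp)]
    simp
  obtain ⟨ns, hns, hae⟩ := (tendstoInMeasure_of_tendsto_eLpNorm two_ne_zero
    (fun n => (hsm _).aestronglyMeasurable) (hsm _).aestronglyMeasurable
    hLp).exists_seq_tendsto_ae
  exact ⟨ns, hns, hνac.ae_le hae⟩

theorem rpow_le_rpow_add_rpow {t p q r : ℝ} (ht : 0 ≤ t) (hp : 0 < p) (hpq : p ≤ q)
    (hqr : q ≤ r) : t ^ q ≤ t ^ p + t ^ r := by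
  rcases le_total t 1 with h | h
  · exact (Real.rpow_le_rpow_of_exponent_ge' ht h hp.le hpq).trans
      (le_add_of_nonneg_right (Real.rpow_nonneg ht _))
  · exact (Real.rpow_le_rpow_of_exponent_le h hqr).trans
      (le_add_of_nonneg_left (Real.rpow_nonneg ht _))

theorem rpow_sub_one_mul_self {t q : ℝ} (ht : 0 ≤ t) (hq : 1 < q) : t ^ (q - 1) * t = t ^ q := by
  conv_lhs => rw [← Real.rpow_one t, ← Real.rpow_mul ht, one_mul]
  rw [← Real.rpow_add_of_nonneg ht (by linarith) zero_le_one, sub_add_cancel]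

theorem add_rpow_le {a b q : ℝ} (ha : 0 ≤ a) (hb : 0 ≤ b) (hq : 0 ≤ q) :
    (a + b) ^ q ≤ 2 ^ q * (a ^ q + b ^ q) := by
  have h : ∀ c : ℝ, 0 ≤ c → (c + c) ^ q = 2 ^ q * c ^ q := fun c hc => by
    rw [← two_mul, Real.mul_rpow zero_le_two hc]
  have h2 : (0 : ℝ) ≤ 2 ^ q := by positivity
  rcases le_total a b with hab | hab
  · calc (a + b) ^ q ≤ (b + b) ^ q := by gcongr
      _ = 2 ^ q * b ^ q := h b hb
      _ ≤ _ := by gcongr; exact le_add_of_nonneg_left (by positivity)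
  · calc (a + b) ^ q ≤ (a + a) ^ q := by gcongr
      _ = 2 ^ q * a ^ q := h a ha
      _ ≤ _ := by gcongr; exact le_add_of_nonneg_right (by positivity)

/-- A form of Young's inequality. -/
theorem rpow_sub_one_mul_le {q δ : ℝ} (hq : 1 < q) (hδ : 0 < δ) {a b : ℝ} (ha : 0 ≤ a)
    (hb : 0 ≤ b) : a ^ (q - 1) * b ≤ δ * a ^ q + (δ⁻¹) ^ (q - 1) * b ^ q := by
  rcases le_total b (δ * a) with h | h
  · calc a ^ (q - 1) * b ≤ a ^ (q - 1) * (δ * a) := by gcongr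
      _ = δ * (a ^ (q - 1) * a) := by ring
      _ = δ * a ^ q := by rw [rpow_sub_one_mul_self ha hq]
      _ ≤ _ := le_add_of_nonneg_right (by positivity)
  · have h1 : a ≤ δ⁻¹ * b := by rwa [le_inv_mul_iff₀ hδ]
    calc a ^ (q - 1) * b ≤ (δ⁻¹ * b) ^ (q - 1) * b := by
          gcongr
      _ = (δ⁻¹) ^ (q - 1) * (b ^ (q - 1) * b) := by
          rw [Real.mul_rpow (by positivity) hb, mul_assoc]
      _ = (δ⁻¹) ^ (q - 1) * b ^ q := by rw [rpow_sub_one_mul_self hb hq]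
      _ ≤ _ := le_add_of_nonneg_left (by positivity)

theorem mul_le_of_growth {K R δ D m s : ℝ} (hR : 2 < R) (hK : 0 ≤ K) (hδ : 0 < δ) (hδ1 : δ ≤ 1)
    (hm : 0 ≤ m) (hs : 0 ≤ s) (hD0 : 0 ≤ D) (hD : D ≤ K * (m + m ^ (R - 1))) :
    D * s ≤ K * δ * (s ^ 2 + s ^ R) + δ⁻¹ * (D * m) := by
  rcases le_total s (δ⁻¹ * m) with h | h
  · calc D * s ≤ D * (δ⁻¹ * m) := by gcongr
      _ = δ⁻¹ * (D * m) := by ring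
      _ ≤ _ := le_add_of_nonneg_left (by positivity)
  · have h1 : m ≤ δ * s := by rwa [inv_mul_le_iff₀ hδ] at h
    have h2 : δ ^ (R - 1) ≤ δ := by
      calc δ ^ (R - 1) ≤ δ ^ (1 : ℝ) :=
            Real.rpow_le_rpow_of_exponent_ge hδ hδ1 (by linarith)
        _ = δ := Real.rpow_one δ
    calc D * s ≤ K * (m + m ^ (R - 1)) * s := by gcongr
      _ ≤ K * (δ * s + (δ * s) ^ (R - 1)) * s := by
          gcongr
          linarith
      _ = K * (δ * s ^ 2 + δ ^ (R - 1) * (s ^ (R - 1) * s)) := by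
          rw [Real.mul_rpow hδ.le hs]
          ring
      _ = K * (δ * s ^ 2 + δ ^ (R - 1) * s ^ R) := by
          rw [rpow_sub_one_mul_self hs (by linarith)]
      _ ≤ K * (δ * s ^ 2 + δ * s ^ R) := by gcongr
      _ = K * δ * (s ^ 2 + s ^ R) := by ring
      _ ≤ _ := le_add_of_nonneg_right (by positivity)

theorem mul_le_of_growth' {K R δ D m s : ℝ} (hR : 2 < R) (hK : 0 ≤ K) (hδ : 0 < δ)
    (hm : 0 ≤ m) (hs : 0 ≤ s) (hD : D ≤ K * (m + m ^ (R - 1))) :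
    D * s ≤ K * δ * (m ^ 2 + m ^ R) + K * (δ⁻¹ * s ^ 2 + (δ⁻¹) ^ (R - 1) * s ^ R) := by
  have h1 := rpow_sub_one_mul_le (q := 2) one_lt_two hδ hm hs
  have h2 := rpow_sub_one_mul_le (q := R) (by linarith) hδ hm hs
  norm_num at h1
  calc D * s ≤ K * (m + m ^ (R - 1)) * s := by gcongr
    _ = K * (m * s + m ^ (R - 1) * s) := by ring
    _ ≤ K * ((δ * m ^ 2 + δ⁻¹ * s ^ 2) + (δ * m ^ R + (δ⁻¹) ^ (R - 1) * s ^ R)) := by gcongr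
    _ = _ := by ring

/-- A dominated convergence theorem where the dominating function has a small varying part. -/
theorem eventually_integral_le_of_le_add {α : Type*} [MeasurableSpace α] {μ : Measure α}
    {P Q : ℕ → α → ℝ} {Z : α → ℝ} {c ε : ℝ} (hε : 0 < ε)
    (hPm : ∀ n, AEStronglyMeasurable (P n) μ) (hP0 : ∀ n x, 0 ≤ P n x)
    (hQ : ∀ n, Integrable (Q n) μ) (hQ0 : ∀ n x, 0 ≤ Q n x) (hZ : Integrable Z μ)
    (hle : ∀ n, ∀ᵐ x ∂μ, P n x ≤ Q n x + Z x)
    (hlim : ∀ᵐ x ∂μ, Tendsto (fun n => P n x) atTop (𝓝 0))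
    (hc : ∀ᶠ n in atTop, ∫ x, Q n x ∂μ ≤ c) :
    ∀ᶠ n in atTop, ∫ x, P n x ∂μ ≤ c + ε := by
  let T : ℕ → α → ℝ := fun n x => max (P n x - Q n x) 0
  have hTm : ∀ n, AEStronglyMeasurable (T n) μ := fun n =>
    ((hPm n).sub (hQ n).aestronglyMeasurable).sup aestronglyMeasurable_const
  have hTZ : ∀ n, ∀ᵐ x ∂μ, ‖T n x‖ ≤ ‖Z x‖ := fun n => by
    filter_upwards [hle n] with x hx
    rw [Real.norm_of_nonneg (le_max_right _ _)]
    exact max_le (by linarith [le_abs_self (Z x), Real.norm_eq_abs (Z x)]) (norm_nonneg _)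
  have hT : Tendsto (fun n => ∫ x, T n x ∂μ) atTop (𝓝 (∫ _x, (0 : ℝ) ∂μ)) := by
    refine tendsto_integral_of_dominated_convergence _ hTm hZ.norm hTZ ?_
    filter_upwards [hlim] with x hx
    exact squeeze_zero (fun n => le_max_right _ _)
      (fun n => max_le (by linarith [hQ0 n x]) (hP0 n x)) hx
  rw [integral_zero] at hT
  filter_upwards [hc, hT.eventually_le_const hε] with n h1 h2
  have hTi : Integrable (T n) μ := hZ.norm.mono' (hTm n) (hTZ n)
  have hPi : Integrable (P n) μ := by
    refine ((hQ n).add hZ).mono' (hPm n) ?_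
    filter_upwards [hle n] with x hx
    rwa [Real.norm_of_nonneg (hP0 n x)]
  calc ∫ x, P n x ∂μ ≤ ∫ x, (Q n x + T n x) ∂μ :=
        integral_mono hPi ((hQ n).add hTi) fun x => by
          have := le_max_left (P n x - Q n x) 0
          change P n x ≤ Q n x + max (P n x - Q n x) 0
          linarith
    _ = ∫ x, Q n x ∂μ + ∫ x, T n x ∂μ := integral_add (hQ n) hTi
    _ ≤ c + ε := add_le_add h1 h2

theorem ENNReal_rpow_le_interpolate {s T : ℝ≥0∞} (hs : s ≠ ⊤) (hT0 : T ≠ 0) {p q r : ℝ}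
    (hp : 0 ≤ p) (hpq : p ≤ q) (hqr : q ≤ r) :
    s ^ q ≤ T ^ (q - p) * s ^ p + T ^ (q - r) * s ^ r := by
  rcases le_total s T with h | h
  · calc s ^ q = s ^ (q - p) * s ^ p := by
          rw [← ENNReal.rpow_add_of_nonneg _ _ (by linarith) hp, sub_add_cancel]
      _ ≤ T ^ (q - p) * s ^ p := mul_le_mul_left (ENNReal.rpow_le_rpow h (by linarith)) _
      _ ≤ _ := le_self_add
  · have hs0 : s ≠ 0 := fun h0 => hT0 (le_antisymm (h0 ▸ h) zero_le)
    calc s ^ q = s ^ (q - r) * s ^ r := by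
          rw [← ENNReal.rpow_add _ _ hs0 hs, sub_add_cancel]
      _ ≤ T ^ (q - r) * s ^ r :=
          mul_le_mul_left (by
            rw [← neg_sub r q, ENNReal.rpow_neg, ENNReal.rpow_neg, ENNReal.inv_le_inv]
            exact ENNReal.rpow_le_rpow h (by linarith)) _
      _ ≤ _ := le_add_self

theorem tendsto_lintegral_rpow_of_interpolate {α F : Type*} [MeasurableSpace α] {μ : Measure α}
    [NormedAddCommGroup F] {d : ℕ → α → F} (hd : ∀ n, AEStronglyMeasurable (d n) μ)
    {p q r : ℝ} (hqr : q ≠ r)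
    (hle : ∀ s T : ℝ≥0∞, s ≠ ⊤ → T ≠ 0 → s ^ q ≤ T ^ (q - p) * s ^ p + T ^ (q - r) * s ^ r)
    {B : ℝ≥0∞} (hB : B ≠ ⊤) (hr : ∀ n, ∫⁻ x, ‖d n x‖ₑ ^ r ∂μ ≤ B)
    (hlim : Tendsto (fun n => ∫⁻ x, ‖d n x‖ₑ ^ p ∂μ) atTop (𝓝 0)) :
    Tendsto (fun n => ∫⁻ x, ‖d n x‖ₑ ^ q ∂μ) atTop (𝓝 0) := by
  rw [ENNReal.tendsto_nhds_zero]
  intro ε hε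
  obtain ⟨δ, hδ, hδε⟩ : ∃ δ : NNReal, 0 < δ ∧ δ * B ≤ ε / 2 := by
    obtain ⟨δ, hδ, h⟩ := ENNReal.exists_nnreal_pos_mul_lt hB (ENNReal.half_pos hε.ne').ne'
    exact ⟨δ, hδ, h.le⟩
  set T : ℝ≥0∞ := (δ : ℝ≥0∞) ^ (q - r)⁻¹ with hTdef
  have hδ0 : (δ : ℝ≥0∞) ≠ 0 := by exact_mod_cast hδ.ne'
  have hT0 : T ≠ 0 := by
    rw [hTdef, Ne, ENNReal.rpow_eq_zero_iff]
    simp [hδ0]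
  have hTt : T ≠ ⊤ := by
    rw [hTdef, Ne, ENNReal.rpow_eq_top_iff]
    simp [hδ0]
  have hTq : T ^ (q - p) ≠ ⊤ := by
    rw [Ne, ENNReal.rpow_eq_top_iff]
    simp [hT0, hTt]
  have hTr : T ^ (q - r) = δ := by
    rw [hTdef, ← ENNReal.rpow_mul, inv_mul_cancel₀ (sub_ne_zero.2 hqr), ENNReal.rpow_one]
  have hlim' := ENNReal.Tendsto.const_mul hlim (a := T ^ (q - p)) (Or.inr hTq)
  rw [mul_zero] at hlim'
  filter_upwards [(ENNReal.tendsto_nhds_zero.1 hlim') (ε / 2) (ENNReal.half_pos hε.ne')] with n hn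
  calc ∫⁻ x, ‖d n x‖ₑ ^ q ∂μ
      ≤ ∫⁻ x, (T ^ (q - p) * ‖d n x‖ₑ ^ p + T ^ (q - r) * ‖d n x‖ₑ ^ r) ∂μ :=
        lintegral_mono fun x => hle _ _ (by finiteness) hT0
    _ = T ^ (q - p) * (∫⁻ x, ‖d n x‖ₑ ^ p ∂μ) + δ * ∫⁻ x, ‖d n x‖ₑ ^ r ∂μ := by
        rw [lintegral_add_left' (((hd n).enorm.pow_const p).const_mul _),
          lintegral_const_mul' _ _ hTq, hTr, lintegral_const_mul' _ _ (by simp)]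
    _ ≤ ε / 2 + δ * B := add_le_add hn (mul_le_mul_right (hr n) _)
    _ ≤ ε / 2 + ε / 2 := by gcongr
    _ = ε := ENNReal.add_halves ε

theorem tendsto_lintegral_rpow_of_tendsto_eLpNorm {α F : Type*} [MeasurableSpace α]
    {μ : Measure α} [NormedAddCommGroup F] {d : ℕ → α → F}
    (hd : ∀ n, AEStronglyMeasurable (d n) μ) {q r : ℝ} (hq : 2 < q) (hqr : q < r)
    {B : ℝ≥0∞} (hB : B ≠ ⊤) (h2 : ∀ n, ∫⁻ x, ‖d n x‖ₑ ^ (2 : ℝ) ∂μ ≤ B)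
    (hr : ∀ n, ∫⁻ x, ‖d n x‖ₑ ^ r ∂μ ≤ B) {p : ℝ≥0∞} (hp : 1 ≤ p)
    (hlim : Tendsto (fun n => eLpNorm (d n) p μ) atTop (𝓝 0)) :
    Tendsto (fun n => ∫⁻ x, ‖d n x‖ₑ ^ q ∂μ) atTop (𝓝 0) := by
  have hp0 : p ≠ 0 := (zero_lt_one.trans_le hp).ne'
  rcases eq_or_ne p ⊤ with rfl | hpt
  · have h1 : Tendsto (fun n => eLpNorm (d n) ⊤ μ ^ (q - 2) * B) atTop (𝓝 0) := by
      have h := ENNReal.Tendsto.mul_const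
        ((ENNReal.continuous_rpow_const (y := q - 2)).tendsto 0 |>.comp hlim) (Or.inr hB)
      rwa [ENNReal.zero_rpow_of_pos (by linarith), zero_mul] at h
    refine tendsto_of_tendsto_of_tendsto_of_le_of_le tendsto_const_nhds h1 (fun _ => zero_le)
      fun n => ?_
    calc ∫⁻ x, ‖d n x‖ₑ ^ q ∂μ
        ≤ ∫⁻ x, eLpNorm (d n) ⊤ μ ^ (q - 2) * ‖d n x‖ₑ ^ (2 : ℝ) ∂μ := by
          refine lintegral_mono_ae ?_
          filter_upwards [enorm_ae_le_eLpNormEssSup (d n) μ] with x hx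
          have e : ‖d n x‖ₑ ^ q = ‖d n x‖ₑ ^ (q - 2) * ‖d n x‖ₑ ^ (2 : ℝ) := by
            rw [← ENNReal.rpow_add_of_nonneg _ _ (by linarith) zero_le_two, sub_add_cancel]
          rw [e, eLpNorm_exponent_top]
          exact mul_le_mul_left (ENNReal.rpow_le_rpow hx (by linarith)) _
      _ = eLpNorm (d n) ⊤ μ ^ (q - 2) * ∫⁻ x, ‖d n x‖ₑ ^ (2 : ℝ) ∂μ :=
          lintegral_const_mul'' _ ((hd n).enorm.pow_const _)
      _ ≤ _ := mul_le_mul_right (h2 n) _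
  · have hp1 : 1 ≤ p.toReal := by
      rw [← ENNReal.toReal_one]
      exact (ENNReal.toReal_le_toReal (by simp) hpt).2 hp
    have hlim' : Tendsto (fun n => ∫⁻ x, ‖d n x‖ₑ ^ p.toReal ∂μ) atTop (𝓝 0) := by
      have h := (ENNReal.continuous_rpow_const (y := p.toReal)).tendsto 0 |>.comp hlim
      rw [ENNReal.zero_rpow_of_pos (by linarith)] at h
      refine h.congr fun n => ?_
      rw [Function.comp_apply, eLpNorm_eq_lintegral_rpow_enorm_toReal hp0 hpt, ← ENNReal.rpow_mul,
        one_div, inv_mul_cancel₀ (by linarith), ENNReal.rpow_one]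
    rcases le_total p.toReal q with h | h
    · exact tendsto_lintegral_rpow_of_interpolate hd hqr.ne
        (fun s T hs hT => ENNReal_rpow_le_interpolate hs hT (by linarith) h hqr.le) hB hr hlim'
    · refine tendsto_lintegral_rpow_of_interpolate hd hq.ne'
        (fun s T hs hT => ?_) hB h2 hlim'
      rw [add_comm]
      exact ENNReal_rpow_le_interpolate hs hT zero_le_two hq.le h

/-- The gauge `t² + t^R` controlling the growth of the energy density. -/
noncomputable def gauge (R t : ℝ) : ℝ := t ^ 2 + t ^ R

theorem gauge_nonneg {R t : ℝ} (ht : 0 ≤ t) : 0 ≤ gauge R t := by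
  unfold gauge
  positivity

theorem gauge_mono {R s t : ℝ} (hR : 0 ≤ R) (hs : 0 ≤ s) (hst : s ≤ t) :
    gauge R s ≤ gauge R t := by
  unfold gauge
  gcongr

theorem gauge_add_le {R a b : ℝ} (hR : 2 ≤ R) (ha : 0 ≤ a) (hb : 0 ≤ b) :
    gauge R (a + b) ≤ 2 ^ R * (gauge R a + gauge R b) := by
  have h1 := add_rpow_le ha hb zero_le_two
  have h2 := add_rpow_le ha hb (zero_le_two.trans hR)
  have h3 : (2 : ℝ) ^ (2 : ℝ) ≤ 2 ^ R := Real.rpow_le_rpow_of_exponent_le one_le_two hR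
  simp only [Real.rpow_two] at h1 h3
  unfold gauge
  calc (a + b) ^ 2 + (a + b) ^ R ≤ 2 ^ R * (a ^ 2 + b ^ 2) + 2 ^ R * (a ^ R + b ^ R) := by
        gcongr
        exact h1.trans (by gcongr)
    _ = _ := by ring

theorem measurable_gauge (R : ℝ) : Measurable (gauge R) := by
  unfold gauge
  fun_prop

theorem integrable_gauge_add {α : Type*} [MeasurableSpace α] {μ : Measure α} {a b : α → ℝ} {R : ℝ}
    (hR : 2 ≤ R) (ha0 : ∀ x, 0 ≤ a x) (hb0 : ∀ x, 0 ≤ b x) (ham : Measurable a)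
    (hbm : Measurable b) (ha : Integrable (fun x => gauge R (a x)) μ)
    (hb : Integrable (fun x => gauge R (b x)) μ) :
    Integrable (fun x => gauge R (a x + b x)) μ ∧
      ∫ x, gauge R (a x + b x) ∂μ ≤
        2 ^ R * (∫ x, gauge R (a x) ∂μ + ∫ x, gauge R (b x) ∂μ) := by
  have hi := (ha.add hb).const_mul (2 ^ R)
  have h1 : Integrable (fun x => gauge R (a x + b x)) μ := by
    refine hi.mono' ((measurable_gauge R).comp (ham.add hbm)).aestronglyMeasurable
      (Eventually.of_forall fun x => ?_)
    rw [Real.norm_of_nonneg (gauge_nonneg (add_nonneg (ha0 x) (hb0 x)))]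
    exact gauge_add_le hR (ha0 x) (hb0 x)
  refine ⟨h1, ?_⟩
  rw [← integral_add ha hb, ← integral_const_mul]
  exact integral_mono h1 hi fun x => gauge_add_le hR (ha0 x) (hb0 x)

theorem measurable_norm_toFun {N : ℕ} (u : H1 N) : Measurable fun x => ‖toFun u x‖ :=
  (stronglyMeasurable_toFun u).measurable.norm

theorem exists_integral_rpow_le {N : ℕ} (hN : 1 ≤ N) {q : ℝ} (hq : 2 ≤ q)
    (hqc : ENNReal.ofReal q ≤ critExp N) :
    ∃ B : ℝ, 0 ≤ B ∧ ∀ u : H1 N, Integrable (fun x => ‖toFun u x‖ ^ q) ∧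
      ∫ x, ‖toFun u x‖ ^ q ≤ B * ‖u‖ ^ q := by
  obtain ⟨B, hB, H⟩ := exists_lintegral_rpow_le hN hq hqc
  have hq0 : 0 ≤ q := by linarith
  refine ⟨B.toReal, ENNReal.toReal_nonneg, fun u => ?_⟩
  have hm : Measurable fun x => ‖toFun u x‖ ^ q := (measurable_norm_toFun u).pow_const q
  have e : ∫⁻ x, ENNReal.ofReal (‖toFun u x‖ ^ q) = ∫⁻ x, ‖toFun u x‖ₑ ^ q := by
    refine lintegral_congr fun x => ?_
    rw [← ENNReal.ofReal_rpow_of_nonneg (norm_nonneg _) hq0, ofReal_norm]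
  have hfin : B * ‖u‖ₑ ^ q ≠ ⊤ := by finiteness
  constructor
  · refine ⟨hm.aestronglyMeasurable, ?_⟩
    rw [hasFiniteIntegral_iff_ofReal (Eventually.of_forall fun x => by positivity), e]
    exact (H u).trans_lt hfin.lt_top
  · rw [integral_eq_lintegral_of_nonneg_ae (Eventually.of_forall fun x => by positivity)
      hm.aestronglyMeasurable, e]
    refine (ENNReal.toReal_mono hfin (H u)).trans (le_of_eq ?_)
    rw [ENNReal.toReal_mul, ← ENNReal.toReal_rpow, toReal_enorm]

theorem exists_integral_gauge_le {N : ℕ} (hN : 1 ≤ N) {R : ℝ} (hR : 2 < R)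
    (hRc : ENNReal.ofReal R ≤ critExp N) :
    ∃ B : ℝ, 0 ≤ B ∧ ∀ u : H1 N, Integrable (fun x => gauge R ‖toFun u x‖) ∧
      ∫ x, gauge R ‖toFun u x‖ ≤ B * gauge R ‖u‖ := by
  obtain ⟨B₁, hB₁, H₁⟩ := exists_integral_rpow_le hN le_rfl
    ((ENNReal.ofReal_le_ofReal hR.le).trans hRc)
  obtain ⟨B₂, hB₂, H₂⟩ := exists_integral_rpow_le hN hR.le hRc
  simp only [Real.rpow_two] at H₁
  refine ⟨B₁ + B₂, add_nonneg hB₁ hB₂, fun u => ⟨(H₁ u).1.add (H₂ u).1, ?_⟩⟩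
  unfold gauge
  rw [integral_add (H₁ u).1 (H₂ u).1]
  have h1 : 0 ≤ ‖u‖ ^ 2 := by positivity
  have h2 : 0 ≤ ‖u‖ ^ R := by positivity
  nlinarith [(H₁ u).2, (H₂ u).2, mul_nonneg hB₁ h2, mul_nonneg hB₂ h1]

theorem exists_integral_gauge_add_le {N : ℕ} (hN : 1 ≤ N) {R : ℝ} (hR : 2 < R)
    (hRc : ENNReal.ofReal R ≤ critExp N) :
    ∃ B : ℝ, 0 ≤ B ∧ ∀ u v : H1 N, Integrable (fun x => gauge R (‖toFun u x‖ + ‖toFun v x‖)) ∧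
      ∫ x, gauge R (‖toFun u x‖ + ‖toFun v x‖) ≤ B * (gauge R ‖u‖ + gauge R ‖v‖) := by
  obtain ⟨B, hB, H⟩ := exists_integral_gauge_le hN hR hRc
  refine ⟨2 ^ R * B, by positivity, fun u v => ?_⟩
  obtain ⟨h1, h2⟩ := integrable_gauge_add hR.le (fun x => norm_nonneg (toFun u x))
    (fun x => norm_nonneg (toFun v x)) (measurable_norm_toFun u) (measurable_norm_toFun v)
    (H u).1 (H v).1
  refine ⟨h1, h2.trans ?_⟩
  rw [mul_assoc, mul_add B]
  exact mul_le_mul_of_nonneg_left (add_le_add (H u).2 (H v).2) (by positivity)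

/-- A nonlinearity that satisfies the Carathéodory and growth conditions at every point. -/
structure IsRegularNonlinearity {N : ℕ} (f : E N → ℝ → ℝ) : Prop where
  measurable : Measurable (Function.uncurry f)
  continuous : ∀ x, Continuous (f x)
  growth : ∃ r : ℝ, 2 < r ∧ ENNReal.ofReal r ≤ critExp N ∧ ∀ ε : ℝ, 0 < ε →
    ∃ p C : ℝ, 2 < p ∧ ENNReal.ofReal p < critExp N ∧ 0 < C ∧
      ∀ x t, 0 ≤ t → |f x t| ≤ ε * (t + t ^ (r - 1)) + C * t ^ (p - 1)

/-- Growth of order at most `R`. -/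
def HasGrowth {N : ℕ} (f : E N → ℝ → ℝ) (R K : ℝ) : Prop :=
  2 < R ∧ ENNReal.ofReal R ≤ critExp N ∧ 0 ≤ K ∧
    ∀ x t, 0 ≤ t → |f x t| ≤ K * (t + t ^ (R - 1))

variable {N : ℕ} {f : E N → ℝ → ℝ}

theorem IsRegularNonlinearity.exists_hasGrowth (hf : IsRegularNonlinearity f) :
    ∃ R K : ℝ, HasGrowth f R K := by
  obtain ⟨r, hr, hrc, H⟩ := hf.growth
  obtain ⟨p, C, hp, hpc, hC, h⟩ := H 1 one_pos
  refine ⟨max r p, 2 + C, lt_max_of_lt_left hr, ?_, by positivity, fun x t ht => ?_⟩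
  · rcases max_cases r p with h | h
    · rw [h.1]; exact hrc
    · rw [h.1]; exact hpc.le
  · have h1 := rpow_le_rpow_add_rpow (p := 1) (q := r - 1) (r := max r p - 1) ht one_pos
      (by linarith) (by linarith [le_max_left r p])
    have h2 := rpow_le_rpow_add_rpow (p := 1) (q := p - 1) (r := max r p - 1) ht one_pos
      (by linarith) (by linarith [le_max_right r p])
    rw [Real.rpow_one] at h1 h2
    have h3 : 0 ≤ t ^ (max r p - 1) := by positivity
    calc |f x t| ≤ 1 * (t + t ^ (r - 1)) + C * t ^ (p - 1) := h x t ht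
      _ ≤ 1 * (t + (t + t ^ (max r p - 1))) + C * (t + t ^ (max r p - 1)) := by gcongr
      _ ≤ _ := by linarith

theorem HasGrowth.apply_zero {R K : ℝ} (h : HasGrowth f R K) (x : E N) : f x 0 = 0 := by
  have := h.2.2.2 x 0 le_rfl
  rw [Real.zero_rpow (by linarith [h.1]), add_zero, mul_zero] at this
  exact abs_eq_zero.1 (le_antisymm this (abs_nonneg _))

theorem norm_extendC (f : E N → ℝ → ℝ) (x : E N) (z : ℂ) : ‖extendC f x z‖ = |f x ‖z‖| := by
  unfold extendC
  split_ifs with h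
  · simp [h]
  · have : ‖z‖ ≠ 0 := norm_ne_zero_iff.2 h
    simp [this]

theorem continuous_extendC {x : E N} (hf : Continuous (f x)) (h0 : f x 0 = 0) :
    Continuous (extendC f x) := by
  rw [continuous_iff_continuousAt]
  intro z
  rcases eq_or_ne z 0 with rfl | hz
  · have e : extendC f x 0 = 0 := by simp [extendC, h0]
    rw [ContinuousAt, e, tendsto_zero_iff_norm_tendsto_zero]
    simp only [norm_extendC]
    have : Continuous fun z : ℂ => |f x ‖z‖| := by fun_prop
    simpa [h0] using this.tendsto 0
  · have h : extendC f x =ᶠ[𝓝 z] fun z => (f x ‖z‖ : ℂ) * (z / (‖z‖ : ℂ)) := by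
      filter_upwards [isOpen_ne.mem_nhds hz] with w hw
      exact if_neg hw
    refine ContinuousAt.congr ?_ h.symm
    have hz' : (‖z‖ : ℂ) ≠ 0 := by simpa using hz
    have h1 : ContinuousAt (fun z : ℂ => (f x ‖z‖ : ℂ)) z := by fun_prop
    have h2 : ContinuousAt (fun z : ℂ => (‖z‖ : ℂ)) z := by fun_prop
    exact h1.mul (continuousAt_id.div h2 hz')

theorem measurable_g (hf : Measurable (Function.uncurry f)) {u : E N → ℂ} (hu : Measurable u) :
    Measurable (g f u) := by
  unfold g extendC
  have h0 : Measurable fun x => (f x 0 : ℂ) :=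
    Complex.measurable_ofReal.comp (hf.comp (measurable_id.prodMk measurable_const))
  have h1 : Measurable fun x => (f x ‖u x‖ : ℂ) :=
    Complex.measurable_ofReal.comp (hf.comp (measurable_id.prodMk hu.norm))
  have h2 : Measurable fun x => (‖u x‖ : ℂ) := Complex.measurable_ofReal.comp hu.norm
  exact Measurable.ite (hu (measurableSet_singleton 0)) h0 (h1.mul (hu.div h2))

theorem measurable_toFun (u : H1 N) : Measurable (toFun u) :=
  (stronglyMeasurable_toFun u).measurable

theorem HasGrowth.mul_le {R K : ℝ} (h : HasGrowth f R K) (x : E N) {a b : ℝ} (ha : 0 ≤ a)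
    (hb : 0 ≤ b) : |f x a| * b ≤ K * (gauge R a + gauge R b) := by
  have := mul_le_of_growth' h.1 h.2.2.1 one_pos ha hb (h.2.2.2 x a ha)
  simp only [inv_one, Real.one_rpow, one_mul, mul_one] at this
  rw [mul_add]
  exact this

theorem HasGrowth.integrable_g_mul {R K : ℝ} (h : HasGrowth f R K) (hN : 1 ≤ N)
    (hf : Measurable (Function.uncurry f)) (u v : H1 N) :
    Integrable fun x => g f (toFun u) x * (starRingEnd ℂ) (toFun v x) := by
  obtain ⟨B, hB, H⟩ := exists_integral_gauge_le hN h.1 h.2.1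
  refine (((H u).1.add (H v).1).const_mul K).mono' ?_ (Eventually.of_forall fun x => ?_)
  · exact ((measurable_g hf (measurable_toFun u)).mul
      (Complex.continuous_conj.measurable.comp (measurable_toFun v))).aestronglyMeasurable
  · rw [norm_mul, g, norm_extendC, RCLike.norm_conj]
    exact h.mul_le x (norm_nonneg _) (norm_nonneg _)

/-- The duality pairing of `g(u)` with `v`. -/
noncomputable def pairing (f : E N → ℝ → ℝ) (u v : H1 N) : ℝ :=
  (∫ x, g f (toFun u) x * (starRingEnd ℂ) (toFun v x)).re

theorem HasGrowth.abs_pairing_le {R K : ℝ} (h : HasGrowth f R K) (hN : 1 ≤ N)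
    (hf : Measurable (Function.uncurry f)) {B : ℝ}
    (H : ∀ u : H1 N, Integrable (fun x => gauge R ‖toFun u x‖) ∧
      ∫ x, gauge R ‖toFun u x‖ ≤ B * gauge R ‖u‖) (u v : H1 N) :
    |pairing f u v| ≤ K * (B * gauge R ‖u‖ + B * gauge R ‖v‖) := by
  calc |pairing f u v| ≤ ‖∫ x, g f (toFun u) x * (starRingEnd ℂ) (toFun v x)‖ :=
        Complex.abs_re_le_norm _
    _ ≤ ∫ x, ‖g f (toFun u) x * (starRingEnd ℂ) (toFun v x)‖ := norm_integral_le_integral_norm _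
    _ ≤ ∫ x, K * (gauge R ‖toFun u x‖ + gauge R ‖toFun v x‖) := by
        refine integral_mono (h.integrable_g_mul hN hf u v).norm
          (((H u).1.add (H v).1).const_mul K) fun x => ?_
        simp only [norm_mul, g, norm_extendC, RCLike.norm_conj]
        exact h.mul_le x (norm_nonneg _) (norm_nonneg _)
    _ = K * ((∫ x, gauge R ‖toFun u x‖) + ∫ x, gauge R ‖toFun v x‖) := by
        rw [integral_const_mul, integral_add (H u).1 (H v).1]
    _ ≤ _ := mul_le_mul_of_nonneg_left (add_le_add (H u).2 (H v).2) h.2.2.1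

theorem gauge_one (R : ℝ) : gauge R 1 = 2 := by
  simp [gauge]
  norm_num

theorem HasGrowth.exists_dual {R K : ℝ} (h : HasGrowth f R K) (hN : 1 ≤ N)
    (hf : Measurable (Function.uncurry f)) :
    ∃ G : H1 N → Hneg1 N, ∀ u v, G u v = pairing f u v := by
  obtain ⟨B, hB, H⟩ := exists_integral_gauge_le hN h.1 h.2.1
  have hi := h.integrable_g_mul hN hf
  have hex : ∀ u : H1 N, ∃ T : Hneg1 N, ∀ v, T v = pairing f u v := by
    intro u
    let L : H1 N →ₗ[ℝ] ℝ :=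
      { toFun := pairing f u
        map_add' := fun v w => by
          unfold pairing
          rw [← Complex.add_re, ← integral_add (hi u v) (hi u w)]
          congr 1
          refine integral_congr_ae ?_
          filter_upwards [toFun_add v w] with x hx
          rw [hx, Pi.add_apply, map_add, mul_add]
        map_smul' := fun c v => by
          unfold pairing
          rw [RingHom.id_apply, ← Complex.smul_re, ← integral_smul]
          congr 1
          refine integral_congr_ae ?_
          filter_upwards [toFun_smul c v] with x hx
          rw [hx, Pi.smul_apply, Complex.real_smul, map_mul, Complex.conj_ofReal,
            Complex.real_smul]
          ring }
    refine ⟨L.mkContinuous (K * (B * gauge R ‖u‖ + B * 2)) fun v => ?_, fun v => rfl⟩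
    have := LinearMap.bound_of_ball_bound' (r := 1) one_pos (K * (B * gauge R ‖u‖ + B * 2)) L
      (fun z hz => ?_) v
    · rwa [div_one] at this
    · refine (h.abs_pairing_le hN hf H u z).trans ?_
      have hz' : ‖z‖ ≤ 1 := by simpa using hz
      have := gauge_mono (R := R) (by linarith [h.1]) (norm_nonneg z) hz'
      rw [gauge_one] at this
      have hK := h.2.2.1
      gcongr
  choose G hG using hex
  exact ⟨G, hG⟩

theorem HasGrowth.isBounded_image {R K : ℝ} (h : HasGrowth f R K) (hN : 1 ≤ N)
    (hf : Measurable (Function.uncurry f)) {G : H1 N → Hneg1 N}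
    (hG : ∀ u v, G u v = pairing f u v) {S : Set (H1 N)} (hS : Bornology.IsBounded S) :
    Bornology.IsBounded (G '' S) := by
  obtain ⟨B, hB, H⟩ := exists_integral_gauge_le hN h.1 h.2.1
  obtain ⟨M, hM⟩ := hS.exists_norm_le
  have hK := h.2.2.1
  refine (isBounded_iff_forall_norm_le (E := Hneg1 N)).2 ⟨K * (B * gauge R |M| + B * 2), ?_⟩
  rintro _ ⟨u, hu, rfl⟩
  have hg := gauge_nonneg (R := R) (abs_nonneg M)
  refine ContinuousLinearMap.opNorm_le_of_unit_norm (by positivity) fun v hv => ?_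
  rw [hG, Real.norm_eq_abs]
  refine (h.abs_pairing_le hN hf H u v).trans ?_
  have := gauge_mono (R := R) (by linarith [h.1]) (norm_nonneg u) ((hM u hu).trans (le_abs_self M))
  rw [hv, gauge_one]
  gcongr

theorem HasGrowth.norm_g_sub_le {R K : ℝ} (h : HasGrowth f R K) (a b : E N → ℂ) (x : E N) :
    ‖g f a x - g f b x‖ ≤ 2 * K * ((‖a x‖ + ‖b x‖) + (‖a x‖ + ‖b x‖) ^ (R - 1)) := by
  have hK := h.2.2.1
  have hmono : ∀ s t : ℝ, 0 ≤ s → s ≤ t → |f x s| ≤ K * (t + t ^ (R - 1)) := fun s t hs hst =>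
    (h.2.2.2 x s hs).trans (by
      have : 0 ≤ R - 1 := by linarith [h.1]
      gcongr)
  refine (norm_sub_le _ _).trans ?_
  rw [g, g, norm_extendC, norm_extendC, two_mul, add_mul]
  exact add_le_add (hmono _ _ (norm_nonneg _) (le_add_of_nonneg_right (norm_nonneg _)))
    (hmono _ _ (norm_nonneg _) (le_add_of_nonneg_left (norm_nonneg _)))

theorem HasGrowth.abs_pairing_sub_le {R K : ℝ} (h : HasGrowth f R K) (hN : 1 ≤ N)
    (hf : Measurable (Function.uncurry f)) (u w v : H1 N) :
    Integrable (fun x => ‖g f (toFun u) x - g f (toFun w) x‖ * ‖toFun v x‖) ∧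
    |pairing f u v - pairing f w v| ≤
      ∫ x, ‖g f (toFun u) x - g f (toFun w) x‖ * ‖toFun v x‖ := by
  have hi := ((h.integrable_g_mul hN hf u v).sub (h.integrable_g_mul hN hf w v)).norm
  have e : ∀ x, ‖g f (toFun u) x * (starRingEnd ℂ) (toFun v x) -
      g f (toFun w) x * (starRingEnd ℂ) (toFun v x)‖ =
      ‖g f (toFun u) x - g f (toFun w) x‖ * ‖toFun v x‖ := fun x => by
    rw [← sub_mul, norm_mul, RCLike.norm_conj]
  simp only [Pi.sub_apply, e] at hi
  refine ⟨hi, ?_⟩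
  unfold pairing
  rw [← Complex.sub_re, ← integral_sub (h.integrable_g_mul hN hf u v)
    (h.integrable_g_mul hN hf w v)]
  refine (Complex.abs_re_le_norm _).trans ((norm_integral_le_integral_norm _).trans ?_)
  simp only [e]
  exact le_rfl

theorem ae_tendsto_g_sub {R K : ℝ} (h : HasGrowth f R K) (hc : ∀ x, Continuous (f x))
    {a : ℕ → E N → ℂ} {b : E N → ℂ} (hae : ∀ᵐ x, Tendsto (fun n => a n x) atTop (𝓝 (b x))) :
    ∀ᵐ x, Tendsto (fun n => ‖g f (a n) x - g f b x‖) atTop (𝓝 0) := by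
  filter_upwards [hae] with x hx
  have := (((continuous_extendC (hc x) (h.apply_zero x)).tendsto _).comp hx).sub_const
    (extendC f x (b x))
  rw [sub_self] at this
  simpa [g, Function.comp_def] using this.norm

theorem measurable_norm_g_sub (hf : Measurable (Function.uncurry f)) (u w : H1 N) :
    Measurable fun x => ‖g f (toFun u) x - g f (toFun w) x‖ :=
  ((measurable_g hf (measurable_toFun u)).sub (measurable_g hf (measurable_toFun w))).norm

/-- Weak continuity of the superposition operator. -/
theorem HasGrowth.tendsto_pairing_of_ae {R K : ℝ} (h : HasGrowth f R K) (hN : 1 ≤ N)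
    (hf : Measurable (Function.uncurry f)) (hc : ∀ x, Continuous (f x)) {u : ℕ → H1 N}
    {u₀ : H1 N} {M : ℝ} (hM : ∀ n, ‖u n‖ ≤ M)
    (hae : ∀ᵐ x, Tendsto (fun n => toFun (u n) x) atTop (𝓝 (toFun u₀ x))) (v : H1 N) :
    Tendsto (fun n => pairing f (u n) v) atTop (𝓝 (pairing f u₀ v)) := by
  obtain ⟨B, hB, H⟩ := exists_integral_gauge_le hN h.1 h.2.1
  obtain ⟨A, hA, J⟩ := exists_integral_gauge_add_le hN h.1 h.2.1
  have hK := h.2.2.1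
  have hM0 : 0 ≤ M := (norm_nonneg _).trans (hM 0)
  set c : ℝ := 2 * K * (A * (gauge R M + gauge R ‖u₀‖)) with hcdef
  have hg1 := gauge_nonneg (R := R) hM0
  have hg2 := gauge_nonneg (R := R) (norm_nonneg u₀)
  have hc0 : 0 ≤ c := by positivity
  rw [Metric.tendsto_nhds]
  intro ε hε
  obtain ⟨δ, hδ, hδc⟩ : ∃ δ : ℝ, 0 < δ ∧ δ * c ≤ ε / 4 :=
    ⟨ε / 4 / (c + 1), by positivity, by
      rw [div_mul_eq_mul_div, div_le_iff₀ (by positivity)]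
      nlinarith⟩
  have key := eventually_integral_le_of_le_add (μ := volume) (c := ε / 4) (ε := ε / 4)
    (P := fun n x => ‖g f (toFun (u n)) x - g f (toFun u₀) x‖ * ‖toFun v x‖)
    (Q := fun n x => 2 * K * δ * gauge R (‖toFun (u n) x‖ + ‖toFun u₀ x‖))
    (Z := fun x => 2 * K * (δ⁻¹ * ‖toFun v x‖ ^ 2 + (δ⁻¹) ^ (R - 1) * ‖toFun v x‖ ^ R))
    (by positivity)
    (fun n => ((measurable_norm_g_sub hf _ _).mul (measurable_norm_toFun v)).aestronglyMeasurable)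
    (fun n x => by positivity) (fun n => (J _ _).1.const_mul _)
    (fun n x => mul_nonneg (by positivity) (gauge_nonneg (by positivity)))
    (by
      obtain ⟨B₁, -, H₁⟩ := exists_integral_rpow_le hN le_rfl
        ((ENNReal.ofReal_le_ofReal h.1.le).trans h.2.1)
      obtain ⟨B₂, -, H₂⟩ := exists_integral_rpow_le hN h.1.le h.2.1
      simp only [Real.rpow_two] at H₁
      exact (((H₁ v).1.const_mul _).add ((H₂ v).1.const_mul _)).const_mul _)
    (fun n => Eventually.of_forall fun x => by
      have := mul_le_of_growth' h.1 (by positivity) hδ (add_nonneg (norm_nonneg (toFun (u n) x))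
        (norm_nonneg (toFun u₀ x))) (norm_nonneg (toFun v x))
        (h.norm_g_sub_le (toFun (u n)) (toFun u₀) x)
      exact this)
    (by
      filter_upwards [ae_tendsto_g_sub h hc hae] with x hx
      simpa using hx.mul_const ‖toFun v x‖)
    (Eventually.of_forall fun n => by
      rw [integral_const_mul]
      calc 2 * K * δ * ∫ x, gauge R (‖toFun (u n) x‖ + ‖toFun u₀ x‖)
          ≤ 2 * K * δ * (A * (gauge R M + gauge R ‖u₀‖)) := by
            have h1 := (J (u n) u₀).2
            have h2 := gauge_mono (R := R) (by linarith [h.1]) (norm_nonneg _) (hM n)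
            gcongr
            exact h1.trans (by gcongr)
        _ = δ * c := by rw [hcdef]; ring
        _ ≤ ε / 4 := hδc)
  filter_upwards [key] with n hn
  rw [Real.dist_eq]
  refine ((h.abs_pairing_sub_le hN hf _ _ _).2.trans hn).trans_lt ?_
  linarith

/-- Strong continuity of the superposition operator along almost everywhere convergent
sequences. -/
theorem HasGrowth.tendsto_dual_of_ae {R K : ℝ} (h : HasGrowth f R K) (hN : 1 ≤ N)
    (hf : Measurable (Function.uncurry f)) (hc : ∀ x, Continuous (f x)) {G : H1 N → Hneg1 N}
    (hG : ∀ u v, G u v = pairing f u v) {u : ℕ → H1 N}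
    {u₀ : H1 N} (hu : Tendsto u atTop (𝓝 u₀))
    (hae : ∀ᵐ x, Tendsto (fun n => toFun (u n) x) atTop (𝓝 (toFun u₀ x))) :
    Tendsto (fun n => G (u n)) atTop (𝓝 (G u₀)) := by
  obtain ⟨B, hB, H⟩ := exists_integral_gauge_le hN h.1 h.2.1
  have hK := h.2.2.1
  have hR := h.1
  let P : ℕ → E N → ℝ := fun n x =>
    ‖g f (toFun (u n)) x - g f (toFun u₀) x‖ * (‖toFun (u n) x‖ + ‖toFun u₀ x‖)
  have hP0 : ∀ n x, 0 ≤ P n x := fun n x => by positivity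
  have hPi : ∀ n, Integrable (P n) := fun n => by
    have := (h.abs_pairing_sub_le hN hf (u n) u₀ (u n)).1.add
      (h.abs_pairing_sub_le hN hf (u n) u₀ u₀).1
    refine this.congr (Eventually.of_forall fun x => ?_)
    simp only [P, Pi.add_apply]
    ring
  have hsmall : ∀ ε : ℝ, 0 < ε → ∀ᶠ n in atTop, ∫ x, P n x ≤ ε := by
    intro ε hε
    have key := eventually_integral_le_of_le_add (μ := volume) (c := ε / 2) (ε := ε / 2)
      (P := P)
      (Q := fun n x => 2 * K * (2 ^ R * gauge R ‖toFun (u n - u₀) x‖))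
      (Z := fun x => 2 * K * (2 ^ R * gauge R (‖toFun u₀ x‖ + ‖toFun u₀ x‖)))
      (by positivity) (fun n => (hPi n).aestronglyMeasurable) hP0
      (fun n => ((H _).1.const_mul _).const_mul _)
      (fun n x => by
        have := gauge_nonneg (R := R) (norm_nonneg (toFun (u n - u₀) x))
        positivity)
      (((integrable_gauge_add hR.le (fun x => norm_nonneg (toFun u₀ x))
        (fun x => norm_nonneg (toFun u₀ x)) (measurable_norm_toFun u₀) (measurable_norm_toFun u₀)
        (H u₀).1 (H u₀).1).1.const_mul _).const_mul _)
      (fun n => by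
        filter_upwards [toFun_sub (u n) u₀] with x hx
        rw [hx, Pi.sub_apply]
        set a := toFun (u n) x
        set b := toFun u₀ x
        have h1 := h.norm_g_sub_le (toFun (u n)) (toFun u₀) x
        have h2 : ‖a‖ ≤ ‖a - b‖ + ‖b‖ := norm_le_norm_sub_add a b
        have h3 : gauge R (‖a‖ + ‖b‖) ≤ gauge R (‖a - b‖ + (‖b‖ + ‖b‖)) :=
          gauge_mono (by linarith) (by positivity) (by linarith)
        have h4 := gauge_add_le hR.le (norm_nonneg (a - b)) (by positivity : 0 ≤ ‖b‖ + ‖b‖)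
        have hm : 0 ≤ ‖a‖ + ‖b‖ := by positivity
        calc P n x ≤ 2 * K * ((‖a‖ + ‖b‖) + (‖a‖ + ‖b‖) ^ (R - 1)) * (‖a‖ + ‖b‖) :=
              mul_le_mul_of_nonneg_right h1 hm
          _ = 2 * K * ((‖a‖ + ‖b‖) ^ 2 + (‖a‖ + ‖b‖) ^ (R - 1) * (‖a‖ + ‖b‖)) := by ring
          _ = 2 * K * gauge R (‖a‖ + ‖b‖) := by
              rw [rpow_sub_one_mul_self hm (by linarith), gauge]
          _ ≤ 2 * K * (2 ^ R * (gauge R ‖a - b‖ + gauge R (‖b‖ + ‖b‖))) := by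
              have := h3.trans h4
              gcongr
          _ = _ := by ring)
      (by
        filter_upwards [ae_tendsto_g_sub h hc hae, hae] with x h1 h2
        simpa using h1.mul (h2.norm.add_const ‖toFun u₀ x‖))
      (by
        have hn : Tendsto (fun n => ‖u n - u₀‖) atTop (𝓝 0) := tendsto_iff_norm_sub_tendsto_zero.1 hu
        have hgc : Continuous (gauge R) := by
          unfold gauge
          exact (continuous_pow 2).add (Real.continuous_rpow_const (by linarith))
        have hg : Tendsto (fun n => 2 * K * (2 ^ R * (B * gauge R ‖u n - u₀‖))) atTop (𝓝 0) := by
          have := ((((hgc.tendsto 0).comp hn).const_mul B).const_mul (2 ^ R)).const_mul (2 * K)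
          simpa [gauge, Real.zero_rpow (by linarith : R ≠ 0)] using this
        filter_upwards [hg.eventually_le_const (by positivity : 0 < ε / 2)] with n hn
        rw [integral_const_mul, integral_const_mul]
        refine le_trans ?_ hn
        gcongr
        exact (H _).2)
    simpa using key
  refine Metric.tendsto_nhds (α := Hneg1 N) |>.2 ?_
  intro ε hε
  obtain ⟨δ, hδ, hδ1, hδc⟩ : ∃ δ : ℝ, 0 < δ ∧ δ ≤ 1 ∧ 2 * K * δ * (B * 2) ≤ ε / 4 := by
    refine ⟨min 1 (ε / 4 / (4 * K * B + 1)), by positivity, min_le_left _ _, ?_⟩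
    calc 2 * K * min 1 (ε / 4 / (4 * K * B + 1)) * (B * 2)
        ≤ 2 * K * (ε / 4 / (4 * K * B + 1)) * (B * 2) := by
          gcongr
          exact min_le_right _ _
      _ = ε / 4 * (4 * K * B / (4 * K * B + 1)) := by ring
      _ ≤ ε / 4 * 1 := by
          gcongr
          rw [div_le_one (by positivity)]
          linarith
      _ = ε / 4 := mul_one _
  filter_upwards [hsmall (δ * (ε / 4)) (by positivity)] with n hn
  refine lt_of_le_of_lt (b := ε / 2) ((dist_eq_norm (E := Hneg1 N) _ _).trans_le ?_)
    (by linarith)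
  refine ContinuousLinearMap.opNorm_le_of_unit_norm (by positivity) fun v hv => ?_
  rw [sub_apply, hG, hG, Real.norm_eq_abs]
  have hgv := (H v).2
  rw [hv, gauge_one] at hgv
  calc |pairing f (u n) v - pairing f u₀ v|
      ≤ ∫ x, ‖g f (toFun (u n)) x - g f (toFun u₀) x‖ * ‖toFun v x‖ :=
        (h.abs_pairing_sub_le hN hf _ _ _).2
    _ ≤ ∫ x, (2 * K * δ * gauge R ‖toFun v x‖ + δ⁻¹ * P n x) :=
        integral_mono (h.abs_pairing_sub_le hN hf _ _ _).1
          (((H v).1.const_mul _).add ((hPi n).const_mul _)) fun x =>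
          mul_le_of_growth hR (by positivity) hδ hδ1 (by positivity) (norm_nonneg _)
            (norm_nonneg _) (h.norm_g_sub_le (toFun (u n)) (toFun u₀) x)
    _ = 2 * K * δ * (∫ x, gauge R ‖toFun v x‖) + δ⁻¹ * ∫ x, P n x := by
        rw [integral_add ((H v).1.const_mul _) ((hPi n).const_mul _), integral_const_mul,
          integral_const_mul]
    _ ≤ 2 * K * δ * (B * 2) + δ⁻¹ * (δ * (ε / 4)) := by gcongr
    _ = 2 * K * δ * (B * 2) + ε / 4 := by rw [inv_mul_cancel_left₀ hδ.ne']
    _ ≤ ε / 2 := by linarith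

theorem HasGrowth.continuous_dual {R K : ℝ} (h : HasGrowth f R K) (hN : 1 ≤ N)
    (hf : Measurable (Function.uncurry f)) (hc : ∀ x, Continuous (f x)) {G : H1 N → Hneg1 N}
    (hG : ∀ u v, G u v = pairing f u v) : Continuous G := by
  refine SeqContinuous.continuous fun u u₀ hu => ?_
  refine tendsto_of_subseq_tendsto fun ns hns => ?_
  have hu' : Tendsto (fun n => u (ns n)) atTop (𝓝 u₀) := hu.comp hns
  obtain ⟨ms, hms, hae⟩ := exists_subseq_ae_tendsto_of_weak
    (tendsto_toWeakSpace_of_forall fun ℓ => (ℓ.continuous.tendsto _).comp hu')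
  exact ⟨ms, h.tendsto_dual_of_ae hN hf hc hG (hu'.comp hms.tendsto_atTop) hae⟩

theorem HasGrowth.tendsto_weak {R K : ℝ} (h : HasGrowth f R K) (hN : 1 ≤ N)
    (hf : Measurable (Function.uncurry f)) (hc : ∀ x, Continuous (f x)) {G : H1 N → Hneg1 N}
    (hG : ∀ u v, G u v = pairing f u v) {u : ℕ → H1 N} {u₀ : H1 N}
    (hu : Tendsto (fun n => toWeakSpace ℝ (H1 N) (u n)) atTop (𝓝 (toWeakSpace ℝ (H1 N) u₀))) :
    Tendsto (fun n => toWeakSpace ℝ (Hneg1 N) (G (u n))) atTop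
      (𝓝 (toWeakSpace ℝ (Hneg1 N) (G u₀))) := by
  refine tendsto_toWeakSpace_Hneg1 fun v => ?_
  simp only [hG]
  obtain ⟨M, hM⟩ := exists_norm_le_of_tendsto_toWeakSpace hu
  refine tendsto_of_subseq_tendsto fun ns hns => ?_
  obtain ⟨ms, hms, hae⟩ := exists_subseq_ae_tendsto_of_weak (u := fun n => u (ns n))
    (hu.comp hns)
  exact ⟨ms, h.tendsto_pairing_of_ae hN hf hc (fun n => hM _) hae v⟩

theorem hasDerivAt_primitive {x : E N} (hc : Continuous (f x)) (t : ℝ) :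
    HasDerivAt (primitive f x) (f x t) t :=
  intervalIntegral.integral_hasDerivAt_right (hc.intervalIntegrable _ _)
    hc.stronglyMeasurable.stronglyMeasurableAtFilter hc.continuousAt

theorem abs_primitive_sub_le {x : E N} (hc : Continuous (f x)) {L m a b : ℝ}
    (hL : ∀ t, 0 ≤ t → t ≤ m → |f x t| ≤ L) (ha : 0 ≤ a) (ham : a ≤ m) (hb : 0 ≤ b)
    (hbm : b ≤ m) : |primitive f x a - primitive f x b| ≤ L * |a - b| :=
  (convex_Icc 0 m).norm_image_sub_le_of_norm_hasDerivWithin_le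
    (fun t _ => (hasDerivAt_primitive hc t).hasDerivWithinAt) (fun t ht => hL t ht.1 ht.2)
    ⟨hb, hbm⟩ ⟨ha, ham⟩

theorem measurable_primitive (hf : Measurable (Function.uncurry f)) (hc : ∀ x, Continuous (f x)) :
    Measurable (Function.uncurry (primitive f)) := by
  have h1 : ∀ t, Measurable fun x => primitive f x t := fun t => by
    have h : ∀ μ : Measure ℝ, SFinite μ → Measurable fun x => ∫ s, f x s ∂μ := fun μ _ =>
      (hf.stronglyMeasurable.integral_prod_right (ν := μ)).measurable
    exact (h _ inferInstance).sub (h _ inferInstance)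
  have h2 := measurable_uncurry_of_continuous_of_measurable (u := fun t x => primitive f x t)
    (fun x => continuous_iff_continuousAt.2 fun t => (hasDerivAt_primitive (hc x) t).continuousAt)
    h1
  exact h2.comp measurable_swap

theorem HasGrowth.abs_primitive_le {R K : ℝ} (h : HasGrowth f R K) {x : E N}
    (hc : Continuous (f x)) {t : ℝ} (ht : 0 ≤ t) : |primitive f x t| ≤ K * gauge R t := by
  have hK := h.2.2.1
  have hR := h.1
  have h1 := abs_primitive_sub_le hc (L := K * (t + t ^ (R - 1))) (m := t) (a := t) (b := 0)
    (fun s hs hst => (h.2.2.2 x s hs).trans (by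
      have : 0 ≤ R - 1 := by linarith
      gcongr)) ht le_rfl le_rfl ht
  have h0 : primitive f x 0 = 0 := intervalIntegral.integral_same
  rw [h0, sub_zero, sub_zero, abs_of_nonneg ht] at h1
  refine h1.trans (le_of_eq ?_)
  rw [gauge, ← rpow_sub_one_mul_self (q := R) ht (by linarith)]
  ring

theorem measurable_primitive_norm (hf : Measurable (Function.uncurry f))
    (hc : ∀ x, Continuous (f x)) {u : E N → ℂ} (hu : Measurable u) :
    Measurable fun x => primitive f x ‖u x‖ :=
  (measurable_primitive hf hc).comp (measurable_id.prodMk hu.norm)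

theorem HasGrowth.integrable_primitive {R K : ℝ} (h : HasGrowth f R K) (hN : 1 ≤ N)
    (hf : Measurable (Function.uncurry f)) (hc : ∀ x, Continuous (f x)) (u : H1 N) :
    Integrable fun x => primitive f x ‖toFun u x‖ := by
  obtain ⟨B, hB, H⟩ := exists_integral_gauge_le hN h.1 h.2.1
  exact ((H u).1.const_mul K).mono'
    (measurable_primitive_norm hf hc (measurable_toFun u)).aestronglyMeasurable
    (Eventually.of_forall fun x => h.abs_primitive_le (hc x) (norm_nonneg _))

theorem HasGrowth.isBounded_image_psi {R K : ℝ} (h : HasGrowth f R K) (hN : 1 ≤ N)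
    (hc : ∀ x, Continuous (f x)) {S : Set (H1 N)} (hS : Bornology.IsBounded S) :
    Bornology.IsBounded (psi f '' S) := by
  obtain ⟨B, hB, H⟩ := exists_integral_gauge_le hN h.1 h.2.1
  obtain ⟨M, hM⟩ := hS.exists_norm_le
  have hK := h.2.2.1
  refine isBounded_iff_forall_norm_le.2 ⟨K * (B * gauge R |M|), ?_⟩
  rintro _ ⟨u, hu, rfl⟩
  calc ‖psi f u‖ ≤ ∫ x, K * gauge R ‖toFun u x‖ :=
        norm_integral_le_of_norm_le ((H u).1.const_mul K)
          (Eventually.of_forall fun x => h.abs_primitive_le (hc x) (norm_nonneg _))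
    _ = K * ∫ x, gauge R ‖toFun u x‖ := integral_const_mul _ _
    _ ≤ K * (B * gauge R ‖u‖) := mul_le_mul_of_nonneg_left (H u).2 hK
    _ ≤ _ := by
        have := gauge_mono (R := R) (by linarith [h.1]) (norm_nonneg u)
          ((hM u hu).trans (le_abs_self M))
        gcongr

/-- The derivative of the energy density along a line. -/
theorem hasDerivAt_primitive_norm_line {x : E N} (hc : Continuous (f x)) (h0 : f x 0 = 0)
    (a b : ℂ) (t : ℝ) :
    HasDerivAt (fun t : ℝ => primitive f x ‖a + t • b‖)
      (extendC f x (a + t • b) * (starRingEnd ℂ) b).re t := by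
  have hline : HasDerivAt (fun t : ℝ => a + t • b) b t := by
    simpa using ((hasDerivAt_id t).smul_const b).const_add a
  set z := a + t • b with hz
  rcases eq_or_ne z 0 with h | h
  · have e : (extendC f x z * (starRingEnd ℂ) b).re = 0 := by simp [h, extendC, h0]
    rw [e]
    have h1 := (hasDerivAt_primitive hc 0)
    rw [h0, hasDerivAt_iff_isLittleO_nhds_zero] at h1
    rw [hasDerivAt_iff_isLittleO_nhds_zero]
    have e2 : ∀ s : ℝ, a + (t + s) • b = s • b := fun s => by
      rw [add_smul, ← add_assoc, ← hz, h, zero_add]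
    have e3 : ∀ s : ℝ, primitive f x ‖a + (t + s) • b‖ - primitive f x ‖z‖ - s • (0 : ℝ) =
        primitive f x (0 + ‖s • b‖) - primitive f x 0 - ‖s • b‖ • (0 : ℝ) := fun s => by
      rw [e2, h, norm_zero, zero_add, smul_zero, smul_zero]
    simp only [← hz]
    refine (Asymptotics.isLittleO_congr (Eventually.of_forall e3) EventuallyEq.rfl).2 ?_
    have ht : Tendsto (fun s : ℝ => ‖s • b‖) (𝓝 0) (𝓝 0) := by
      have : Continuous fun s : ℝ => ‖s • b‖ := by fun_prop
      simpa using this.tendsto 0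
    refine (h1.comp_tendsto ht).trans_isBigO ?_
    refine Asymptotics.IsBigO.of_bound ‖b‖ (Eventually.of_forall fun s => ?_)
    simp [mul_comm]
  · have hn : ‖z‖ ≠ 0 := norm_ne_zero_iff.2 h
    have h1 := hline.norm_sq
    have h2 := h1.sqrt (by rw [← hz]; positivity)
    simp only [Real.sqrt_sq (norm_nonneg _)] at h2
    have h3 := (hasDerivAt_primitive hc ‖z‖).comp t h2
    refine h3.congr_deriv ?_
    rw [extendC, if_neg h, ← hz, Complex.inner]
    have e : (f x ‖z‖ : ℂ) * (z / (‖z‖ : ℂ)) * (starRingEnd ℂ) b =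
        ((f x ‖z‖ / ‖z‖ : ℝ) : ℂ) * (z * (starRingEnd ℂ) b) := by
      push_cast
      ring
    rw [e, Complex.re_ofReal_mul]
    have e4 : (z * (starRingEnd ℂ) b).re = ((starRingEnd ℂ) z * b).re := by
      simp [Complex.mul_re]
    rw [e4]
    field_simp

theorem psi_add_smul (u v : H1 N) (t : ℝ) :
    psi f (u + t • v) = ∫ x, primitive f x ‖toFun u x + t • toFun v x‖ := by
  refine integral_congr_ae ?_
  filter_upwards [toFun_add u (t • v), toFun_smul t v] with x h1 h2
  rw [h1, Pi.add_apply, h2, Pi.smul_apply]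

theorem pairing_add_smul (u v : H1 N) (t : ℝ) :
    pairing f (u + t • v) v =
      (∫ x, extendC f x (toFun u x + t • toFun v x) * (starRingEnd ℂ) (toFun v x)).re := by
  unfold pairing
  congr 1
  refine integral_congr_ae ?_
  filter_upwards [toFun_add u (t • v), toFun_smul t v] with x h1 h2
  rw [g, h1, Pi.add_apply, h2, Pi.smul_apply]

theorem HasGrowth.hasDerivAt_psi_line {R K : ℝ} (h : HasGrowth f R K) (hN : 1 ≤ N)
    (hf : Measurable (Function.uncurry f)) (hc : ∀ x, Continuous (f x)) (u v : H1 N) (t : ℝ) :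
    HasDerivAt (fun t : ℝ => psi f (u + t • v)) (pairing f (u + t • v) v) t := by
  obtain ⟨B, hB, H⟩ := exists_integral_gauge_le hN h.1 h.2.1
  have hK := h.2.2.1
  have hR := h.1
  set c : ℝ := |t| + 1 with hcdef
  have hc0 : 0 ≤ c := by positivity
  have hu := measurable_toFun u
  have hv := measurable_toFun v
  have hadd : ∀ s : ℝ, Measurable fun x => toFun u x + s • toFun v x := fun s =>
    hu.add (hv.const_smul s)
  have hgcv : Integrable fun x => gauge R (c * ‖toFun v x‖) := by
    refine (H (c • v)).1.congr ?_
    filter_upwards [toFun_smul c v] with x hx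
    rw [hx, Pi.smul_apply, norm_smul, Real.norm_of_nonneg hc0]
  have hbound := (integrable_gauge_add hR.le (fun x => norm_nonneg (toFun u x))
    (fun x => mul_nonneg hc0 (norm_nonneg (toFun v x))) hu.norm (hv.norm.const_mul c)
    (H u).1 hgcv).1.const_mul K
  have hmem : ∀ s : ℝ, Measurable fun x =>
      extendC f x (toFun u x + s • toFun v x) * (starRingEnd ℂ) (toFun v x) := fun s =>
    (measurable_g hf (hadd s)).mul (Complex.continuous_conj.measurable.comp hv)
  have key := hasDerivAt_integral_of_dominated_loc_of_deriv_le (μ := volume)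
    (F := fun s x => primitive f x ‖toFun u x + s • toFun v x‖)
    (F' := fun s x => (extendC f x (toFun u x + s • toFun v x) * (starRingEnd ℂ) (toFun v x)).re)
    (x₀ := t) (Metric.ball_mem_nhds t one_pos)
    (Eventually.of_forall fun s =>
      (measurable_primitive_norm hf hc (hadd s)).aestronglyMeasurable)
    (by
      refine (h.integrable_primitive hN hf hc (u + t • v)).congr ?_
      filter_upwards [toFun_add u (t • v), toFun_smul t v] with x h1 h2
      rw [h1, Pi.add_apply, h2, Pi.smul_apply])
    (Complex.measurable_re.comp (hmem t)).aestronglyMeasurable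
    (Eventually.of_forall fun x s hs => by
      have hs' : |s| ≤ c := by
        rw [Metric.mem_ball, Real.dist_eq] at hs
        have := abs_sub_abs_le_abs_sub s t
        linarith
      set m := ‖toFun u x‖ + c * ‖toFun v x‖ with hm
      have hm0 : 0 ≤ m := by positivity
      have h1 : ‖toFun u x + s • toFun v x‖ ≤ m := by
        refine (norm_add_le _ _).trans ?_
        rw [norm_smul, Real.norm_eq_abs, hm]
        gcongr
      have h2 : ‖toFun v x‖ ≤ m := by
        have : 1 * ‖toFun v x‖ ≤ c * ‖toFun v x‖ := by
          gcongr
          linarith [abs_nonneg t]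
        linarith [norm_nonneg (toFun u x)]
      have h3 : 0 ≤ R - 1 := by linarith
      calc ‖(extendC f x (toFun u x + s • toFun v x) * (starRingEnd ℂ) (toFun v x)).re‖
          ≤ |f x ‖toFun u x + s • toFun v x‖| * ‖toFun v x‖ := by
            rw [Real.norm_eq_abs]
            refine (Complex.abs_re_le_norm _).trans (le_of_eq ?_)
            rw [norm_mul, norm_extendC, RCLike.norm_conj]
        _ ≤ K * (m + m ^ (R - 1)) * m := by
            have h4 := h.2.2.2 x _ (norm_nonneg (toFun u x + s • toFun v x))
            gcongr
            exact h4.trans (by gcongr)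
        _ = K * gauge R m := by
            rw [gauge, ← rpow_sub_one_mul_self (q := R) hm0 (by linarith)]
            ring)
    hbound
    (Eventually.of_forall fun x s _ =>
      hasDerivAt_primitive_norm_line (hc x) (h.apply_zero x) _ _ s)
  simp only [psi_add_smul, pairing_add_smul]
  refine key.2.congr_deriv ?_
  have hint : Integrable fun x =>
      extendC f x (toFun u x + t • toFun v x) * (starRingEnd ℂ) (toFun v x) := by
    refine (h.integrable_g_mul hN hf (u + t • v) v).congr ?_
    filter_upwards [toFun_add u (t • v), toFun_smul t v] with x h1 h2
    rw [g, h1, Pi.add_apply, h2, Pi.smul_apply]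
  exact integral_re hint

theorem hasFDerivAt_of_hasDerivAt_line {V : Type*} [NormedAddCommGroup V] [NormedSpace ℝ V]
    {ψ : V → ℝ} {G : V → StrongDual ℝ V} (hG : Continuous G)
    (h : ∀ u v (t : ℝ), HasDerivAt (fun t : ℝ => ψ (u + t • v)) (G (u + t • v) v) t) (u : V) :
    HasFDerivAt ψ (G u) u := by
  rw [hasFDerivAt_iff_isLittleO_nhds_zero, Asymptotics.isLittleO_iff]
  intro ε hε
  obtain ⟨δ, hδ, hball⟩ := Metric.continuousAt_iff.1 (hG.continuousAt (x := u)) ε hε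
  filter_upwards [Metric.ball_mem_nhds (0 : V) hδ] with v hv
  have hv' : ‖v‖ < δ := by simpa using hv
  have hd : ∀ t ∈ Set.Icc (0 : ℝ) 1, HasDerivWithinAt (fun t : ℝ => ψ (u + t • v) - t * G u v)
      (G (u + t • v) v - G u v) (Set.Icc 0 1) t := fun t _ => by
    have := (h u v t).sub ((hasDerivAt_id t).mul_const (G u v))
    rw [one_mul] at this
    exact this.hasDerivWithinAt
  have hb : ∀ t ∈ Set.Icc (0 : ℝ) 1, ‖G (u + t • v) v - G u v‖ ≤ ε * ‖v‖ := fun t ht => by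
    rw [← sub_apply]
    refine (ContinuousLinearMap.le_opNorm _ _).trans ?_
    gcongr
    rw [← dist_eq_norm]
    refine (hball ?_).le
    rw [dist_eq_norm, add_sub_cancel_left, norm_smul, Real.norm_of_nonneg ht.1]
    exact (mul_le_of_le_one_left (norm_nonneg _) ht.2).trans_lt hv'
  have := (convex_Icc (0 : ℝ) 1).norm_image_sub_le_of_norm_hasDerivWithin_le hd hb
    (Set.left_mem_Icc.2 zero_le_one) (Set.right_mem_Icc.2 zero_le_one)
  simpa [sub_right_comm] using this

theorem HasGrowth.locallyIntegrable_g {R K : ℝ} (h : HasGrowth f R K) (hN : 1 ≤ N)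
    (hf : Measurable (Function.uncurry f)) (u : H1 N) : LocallyIntegrable (g f (toFun u)) := by
  obtain ⟨B, hB, H⟩ := exists_integral_gauge_le hN h.1 h.2.1
  have hK := h.2.2.1
  have hR := h.1
  have hdom : LocallyIntegrable fun x => 2 * K + K * gauge R ‖toFun u x‖ :=
    (locallyIntegrable_const _).add ((H u).1.const_mul K).locallyIntegrable
  refine hdom.mono (measurable_g hf (measurable_toFun u)).aestronglyMeasurable
    (Eventually.of_forall fun x => ?_)
  set t := ‖toFun u x‖
  have ht : 0 ≤ t := norm_nonneg _
  have h1 : t ≤ 1 + t ^ 2 := by nlinarith [sq_nonneg (t - 1)]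
  have h2 : t ^ (R - 1) ≤ 1 + t ^ R := by
    rcases le_total t 1 with h | h
    · exact (Real.rpow_le_one ht h (by linarith)).trans
        (le_add_of_nonneg_right (Real.rpow_nonneg ht _))
    · exact (Real.rpow_le_rpow_of_exponent_le h (by linarith)).trans
        (le_add_of_nonneg_left zero_le_one)
  rw [g, norm_extendC]
  calc |f x t| ≤ K * (t + t ^ (R - 1)) := h.2.2.2 x t ht
    _ ≤ K * ((1 + t ^ 2) + (1 + t ^ R)) := by gcongr
    _ = 2 * K + K * gauge R t := by rw [gauge]; ring
    _ ≤ _ := le_abs_self _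

theorem tendsto_integral_norm_sub_rpow (hN : 1 ≤ N) {q : ℝ} (hq : 2 < q)
    (hqc : ENNReal.ofReal q < critExp N) {u v : ℕ → H1 N} {M : ℝ} (hu : ∀ n, ‖u n‖ ≤ M)
    (hv : ∀ n, ‖v n‖ ≤ M) {p : ℝ≥0∞} (hp : 1 ≤ p)
    (hlim : Tendsto (fun n => eLpNorm (fun x => toFun (u n) x - toFun (v n) x) p volume) atTop
      (𝓝 0)) :
    Tendsto (fun n => ∫ x, ‖toFun (u n - v n) x‖ ^ q) atTop (𝓝 0) := by
  obtain ⟨c, hqc', hc⟩ := exists_between hqc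
  have hct : c ≠ ⊤ := ne_top_of_lt hc
  have hqr : q < c.toReal := (ENNReal.ofReal_lt_iff_lt_toReal (by linarith) hct).1 hqc'
  have hM : ∀ n, ‖u n - v n‖ₑ ≤ ENNReal.ofReal (2 * M) := fun n => by
    rw [← ofReal_norm]
    refine ENNReal.ofReal_le_ofReal ((norm_sub_le _ _).trans ?_)
    linarith [hu n, hv n]
  have hbdd : ∀ s : ℝ, 2 ≤ s → ENNReal.ofReal s ≤ critExp N →
      ∃ B : ℝ≥0∞, B ≠ ⊤ ∧ ∀ n, ∫⁻ x, ‖toFun (u n - v n) x‖ₑ ^ s ≤ B := by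
    intro s hs hsc
    obtain ⟨B, hB, H⟩ := exists_lintegral_rpow_le hN hs hsc
    refine ⟨B * ENNReal.ofReal (2 * M) ^ s, by finiteness, fun n => (H _).trans ?_⟩
    have := hM n
    gcongr
  obtain ⟨B₁, hB₁, H₁⟩ := hbdd 2 le_rfl ((ENNReal.ofReal_le_ofReal hq.le).trans hqc.le)
  obtain ⟨B₂, hB₂, H₂⟩ := hbdd c.toReal (by linarith) (by rw [ENNReal.ofReal_toReal hct]; exact hc.le)
  have key := tendsto_lintegral_rpow_of_tendsto_eLpNorm
    (d := fun n => toFun (u n - v n)) (μ := volume)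
    (fun n => (stronglyMeasurable_toFun _).aestronglyMeasurable) hq hqr (B := B₁ + B₂)
    (by finiteness) (fun n => (H₁ n).trans le_self_add) (fun n => (H₂ n).trans le_add_self) hp
    (hlim.congr fun n => eLpNorm_congr_ae (toFun_sub (u n) (v n)).symm)
  have := (ENNReal.tendsto_toReal (by simp)).comp key
  refine this.congr fun n => ?_
  rw [integral_eq_lintegral_of_nonneg_ae (Eventually.of_forall fun x => by positivity)
    ((measurable_norm_toFun _).pow_const q).aestronglyMeasurable]
  simp only [Function.comp_apply]
  congr 1
  refine lintegral_congr fun x => ?_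
  rw [← ENNReal.ofReal_rpow_of_nonneg (norm_nonneg _) (by linarith), ofReal_norm]

theorem abs_primitive_sub_le_of_growth {x : E N} (hc : Continuous (f x)) {r p ε C η : ℝ}
    (hr : 2 < r) (hp : 2 < p) (hε : 0 < ε) (hC : 0 < C) (hη : 0 < η)
    (hgr : ∀ t, 0 ≤ t → |f x t| ≤ ε * (t + t ^ (r - 1)) + C * t ^ (p - 1)) (a b : ℂ) :
    |primitive f x ‖a‖ - primitive f x ‖b‖| ≤ ε * gauge r (‖a‖ + ‖b‖) +
      C * (η * gauge p (‖a‖ + ‖b‖) + (η⁻¹) ^ (p - 1) * ‖a - b‖ ^ p) := by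
  set m := ‖a‖ + ‖b‖ with hm
  have hm0 : 0 ≤ m := by positivity
  have hr' : 0 ≤ r - 1 := by linarith
  have hp' : 0 ≤ p - 1 := by linarith
  have h1 := abs_primitive_sub_le hc (L := ε * (m + m ^ (r - 1)) + C * m ^ (p - 1)) (m := m)
    (fun t ht htm => (hgr t ht).trans (by gcongr)) (norm_nonneg a)
    (le_add_of_nonneg_right (norm_nonneg b)) (norm_nonneg b)
    (le_add_of_nonneg_left (norm_nonneg a))
  have h2 := rpow_sub_one_mul_le (q := p) (by linarith) hη hm0 (norm_nonneg (a - b))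
  have h3 : m ^ p ≤ gauge p m := le_add_of_nonneg_left (sq_nonneg m)
  calc |primitive f x ‖a‖ - primitive f x ‖b‖|
      ≤ (ε * (m + m ^ (r - 1)) + C * m ^ (p - 1)) * |‖a‖ - ‖b‖| := h1
    _ ≤ (ε * (m + m ^ (r - 1)) + C * m ^ (p - 1)) * ‖a - b‖ := by
        gcongr
        exact abs_norm_sub_norm_le a b
    _ = ε * (m + m ^ (r - 1)) * ‖a - b‖ + C * (m ^ (p - 1) * ‖a - b‖) := by ring
    _ ≤ ε * (m + m ^ (r - 1)) * m + C * (η * gauge p m + (η⁻¹) ^ (p - 1) * ‖a - b‖ ^ p) := by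
        gcongr
        · exact norm_sub_le a b
        · exact h2.trans (by gcongr)
    _ = _ := by
        have e : (m + m ^ (r - 1)) * m = gauge r m := by
          rw [gauge, ← rpow_sub_one_mul_self (q := r) hm0 (by linarith)]
          ring
        rw [mul_assoc ε, e]

theorem exists_pos_mul_le {c ε : ℝ} (hc : 0 ≤ c) (hε : 0 < ε) : ∃ δ : ℝ, 0 < δ ∧ δ * c ≤ ε :=
  ⟨ε / (c + 1), by positivity, by
    rw [div_mul_eq_mul_div, div_le_iff₀ (by positivity)]
    nlinarith⟩

theorem IsRegularNonlinearity.tendsto_psi_sub (hf : IsRegularNonlinearity f) (hN : 1 ≤ N)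
    {u v : ℕ → H1 N} (hu : Bornology.IsBounded (Set.range u))
    (hv : Bornology.IsBounded (Set.range v)) {p₀ : ℝ≥0∞} (hp₀ : 1 ≤ p₀)
    (hlim : Tendsto (fun n => eLpNorm (fun x => toFun (u n) x - toFun (v n) x) p₀ volume) atTop
      (𝓝 0)) :
    Tendsto (fun n => |psi f (u n) - psi f (v n)|) atTop (𝓝 0) := by
  obtain ⟨R, K, hRK⟩ := hf.exists_hasGrowth
  obtain ⟨r, hr, hrc, hgr⟩ := hf.growth
  obtain ⟨A, hA, J⟩ := exists_integral_gauge_add_le hN hr hrc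
  obtain ⟨M₁, hM₁⟩ := hu.exists_norm_le
  obtain ⟨M₂, hM₂⟩ := hv.exists_norm_le
  have hu' : ∀ n, ‖u n‖ ≤ max M₁ M₂ := fun n => (hM₁ _ ⟨n, rfl⟩).trans (le_max_left _ _)
  have hv' : ∀ n, ‖v n‖ ≤ max M₁ M₂ := fun n => (hM₂ _ ⟨n, rfl⟩).trans (le_max_right _ _)
  set M := max M₁ M₂
  have hM0 : 0 ≤ M := (norm_nonneg _).trans (hu' 0)
  have hbd : ∀ s B : ℝ, 2 < s → 0 ≤ B → ∀ n,
      B * (gauge s ‖u n‖ + gauge s ‖v n‖) ≤ B * (gauge s M + gauge s M) := fun s B hs hB n => by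
    have h1 := gauge_mono (R := s) (by linarith) (norm_nonneg _) (hu' n)
    have h2 := gauge_mono (R := s) (by linarith) (norm_nonneg _) (hv' n)
    gcongr
  have hgM : ∀ s, 0 ≤ gauge s M := fun s => gauge_nonneg hM0
  rw [Metric.tendsto_nhds]
  intro ε₀ hε₀
  obtain ⟨ε, hε, hεA⟩ := exists_pos_mul_le (c := A * (gauge r M + gauge r M)) (ε := ε₀ / 4)
    (mul_nonneg hA (add_nonneg (hgM r) (hgM r))) (by positivity)
  obtain ⟨p, C, hp, hpc, hC, hfg⟩ := hgr ε hε
  obtain ⟨A', hA', J'⟩ := exists_integral_gauge_add_le hN hp hpc.le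
  obtain ⟨η, hη, hηA⟩ := exists_pos_mul_le (c := C * (A' * (gauge p M + gauge p M)))
    (ε := ε₀ / 4) (mul_nonneg hC.le (mul_nonneg hA' (add_nonneg (hgM p) (hgM p)))) (by positivity)
  obtain ⟨B, -, H⟩ := exists_integral_rpow_le hN hp.le hpc.le
  have hI := ((tendsto_integral_norm_sub_rpow hN hp hpc hu' hv' hp₀ hlim).const_mul
    ((η⁻¹) ^ (p - 1))).const_mul C
  rw [mul_zero, mul_zero] at hI
  filter_upwards [hI.eventually_le_const (by positivity : 0 < ε₀ / 4)] with n hn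
  rw [Real.dist_eq, sub_zero, abs_abs]
  have i1 := (J (u n) (v n)).1.const_mul ε
  have i2 := (J' (u n) (v n)).1.const_mul η
  have i3 := (H (u n - v n)).1.const_mul ((η⁻¹) ^ (p - 1))
  have i4 : Integrable fun x => C * (η * gauge p (‖toFun (u n) x‖ + ‖toFun (v n) x‖) +
      (η⁻¹) ^ (p - 1) * ‖toFun (u n - v n) x‖ ^ p) := (i2.add i3).const_mul C
  have hJ := (J (u n) (v n)).2.trans (hbd r A hr hA n)
  have hJ' := (J' (u n) (v n)).2.trans (hbd p A' hp hA' n)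
  calc |psi f (u n) - psi f (v n)|
      = ‖∫ x, (primitive f x ‖toFun (u n) x‖ - primitive f x ‖toFun (v n) x‖)‖ := by
        rw [integral_sub (hRK.integrable_primitive hN hf.measurable hf.continuous _)
          (hRK.integrable_primitive hN hf.measurable hf.continuous _), Real.norm_eq_abs]
        rfl
    _ ≤ ∫ x, (ε * gauge r (‖toFun (u n) x‖ + ‖toFun (v n) x‖) +
          C * (η * gauge p (‖toFun (u n) x‖ + ‖toFun (v n) x‖) +
            (η⁻¹) ^ (p - 1) * ‖toFun (u n - v n) x‖ ^ p)) := by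
        refine norm_integral_le_of_norm_le (i1.add i4) ?_
        filter_upwards [toFun_sub (u n) (v n)] with x hx
        rw [hx, Pi.sub_apply]
        exact abs_primitive_sub_le_of_growth (hf.continuous x) hr hp hε hC hη (hfg x) _ _
    _ = ε * (∫ x, gauge r (‖toFun (u n) x‖ + ‖toFun (v n) x‖)) +
          (η * (C * ∫ x, gauge p (‖toFun (u n) x‖ + ‖toFun (v n) x‖)) +
            C * ((η⁻¹) ^ (p - 1) * ∫ x, ‖toFun (u n - v n) x‖ ^ p)) := by
        rw [integral_add i1 i4, integral_const_mul, integral_const_mul,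
          integral_add i2 i3, integral_const_mul, integral_const_mul]
        ring
    _ ≤ ε₀ / 4 + (ε₀ / 4 + ε₀ / 4) := by
        refine add_le_add (le_trans ?_ hεA) (add_le_add (le_trans ?_ hηA) hn)
        · gcongr
        · gcongr
    _ < ε₀ := by linarith

theorem exists_seq_rat_tendsto (t : ℝ) : ∃ q : ℕ → ℚ, Tendsto (fun k => (q k : ℝ)) atTop (𝓝 t) := by
  obtain ⟨s, hs, hlim⟩ := mem_closure_iff_seq_limit.1 (Rat.denseRange_cast (𝕜 := ℝ) t)
  choose q hq using hs
  exact ⟨q, by simpa only [hq] using hlim⟩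

theorem exists_growth_exponent (N : ℕ) : ∃ r : ℝ, 2 < r ∧ ENNReal.ofReal r ≤ critExp N ∧
    ∀ ε t : ℝ, 0 < ε → 0 ≤ t →
      (if 3 ≤ N then ε * (t + t ^ ((critExp N).toReal - 1)) else ε * t) ≤
        ε * (t + t ^ (r - 1)) := by
  by_cases hN : 3 ≤ N
  · have hN' : (3 : ℝ) ≤ N := by exact_mod_cast hN
    have e : critExp N = ENNReal.ofReal (2 * N / (N - 2)) := by rw [critExp, if_neg (by omega)]
    refine ⟨2 * N / (N - 2), ?_, e.ge, fun ε t _ _ => ?_⟩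
    · rw [lt_div_iff₀ (by linarith)]
      linarith
    · rw [if_pos hN, e, ENNReal.toReal_ofReal (div_nonneg (by linarith) (by linarith))]
  · refine ⟨3, by norm_num, ?_, fun ε t hε ht => ?_⟩
    · rw [critExp, if_pos (by omega)]
      exact le_top
    · rw [if_neg hN]
      have := Real.rpow_nonneg ht (3 - 1)
      gcongr
      linarith

/-- A subcritical Carathéodory function agrees, up to a null set of points, with a regular one. -/
theorem exists_isRegularNonlinearity (hf : IsCaratheodory f) (hsub : IsSubcritical f) :
    ∃ f' : E N → ℝ → ℝ, IsRegularNonlinearity f' ∧ ∀ᵐ x, ∀ t, 0 ≤ t → f x t = f' x t := by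
  obtain ⟨r, hr, hrc, hrε⟩ := exists_growth_exponent N
  have hsub' : ∀ n : ℕ, ∃ p C : ℝ, 2 < p ∧ ENNReal.ofReal p < critExp N ∧ 0 < C ∧
      ∀ᵐ x : E N, ∀ t : ℝ, 0 ≤ t →
        |f x t| ≤ 1 / ((n : ℝ) + 1) * (t + t ^ (r - 1)) + C * t ^ (p - 1) := by
    intro n
    have hn : (0 : ℝ) < 1 / ((n : ℝ) + 1) := by positivity
    obtain ⟨p, C, hp, hpc, hC, h⟩ := hsub _ hn
    refine ⟨p, C, hp, hpc, hC, ?_⟩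
    filter_upwards [h] with x hx t ht
    exact (hx t ht).trans (by gcongr; exact hrε _ _ hn ht)
  choose p C hp hpc hC hgr using hsub'
  have hmk : ∀ᵐ x : E N, ∀ q : ℚ, ∀ hq : 0 ≤ (q : ℝ), f x q = (hf.1 q hq).mk _ x := by
    rw [ae_all_iff]
    intro q
    by_cases hq : 0 ≤ (q : ℝ)
    · filter_upwards [(hf.1 q hq).ae_eq_mk] with x hx _
      exact hx
    · exact Eventually.of_forall fun x h => absurd h hq
  obtain ⟨S, hS, hSm, hSP⟩ := ((hf.2.and (ae_all_iff.2 hgr)).and hmk).exists_measurable_mem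
  let f' : E N → ℝ → ℝ := fun x t => S.indicator (fun x => f x (max t 0)) x
  have hf'S : ∀ x ∈ S, ∀ t, f' x t = f x (max t 0) := fun x hx t => Set.indicator_of_mem hx _
  have hf'S' : ∀ x ∉ S, ∀ t, f' x t = 0 := fun x hx t => Set.indicator_of_notMem hx _
  have hcont : ∀ x, Continuous (f' x) := by
    intro x
    by_cases hx : x ∈ S
    · have : f' x = fun t => f x (max t 0) := funext (hf'S x hx)
      rw [this]
      exact (hSP x hx).1.1.comp_continuous (by fun_prop) fun t => le_max_right t 0
    · have : f' x = fun _ => 0 := funext (hf'S' x hx)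
      rw [this]
      exact continuous_const
  have hrat : ∀ q : ℚ, Measurable fun x => f' x q := by
    intro q
    have hq : (0 : ℝ) ≤ ((max q 0 : ℚ) : ℝ) := by exact_mod_cast le_max_right q 0
    have e : (fun x => f' x q) = S.indicator ((hf.1 _ hq).mk _) := by
      funext x
      by_cases hx : x ∈ S
      · rw [hf'S x hx, Set.indicator_of_mem hx, ← (hSP x hx).2 _ hq]
        push_cast
        rfl
      · rw [hf'S' x hx, Set.indicator_of_notMem hx]
    rw [e]
    exact (hf.1 _ hq).measurable_mk.indicator hSm
  have hmeas : ∀ t, Measurable fun x => f' x t := by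
    intro t
    obtain ⟨q, hq⟩ := exists_seq_rat_tendsto t
    refine measurable_of_tendsto_metrizable (fun k => hrat (q k)) (tendsto_pi_nhds.2 fun x => ?_)
    exact ((hcont x).tendsto t).comp hq
  refine ⟨f', ⟨?_, hcont, r, hr, hrc, fun ε hε => ?_⟩, ?_⟩
  · exact (measurable_uncurry_of_continuous_of_measurable (u := fun t x => f' x t) hcont
      hmeas).comp measurable_swap
  · obtain ⟨n, hn⟩ := exists_nat_one_div_lt hε
    refine ⟨p n, C n, hp n, hpc n, hC n, fun x t ht => ?_⟩
    have h1 : 0 ≤ t ^ (r - 1) := Real.rpow_nonneg ht _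
    have h2 : 0 ≤ t ^ (p n - 1) := Real.rpow_nonneg ht _
    by_cases hx : x ∈ S
    · rw [hf'S x hx, max_eq_left ht]
      refine ((hSP x hx).1.2 n t ht).trans ?_
      gcongr
    · rw [hf'S' x hx, abs_zero]
      have := (hC n).le
      positivity
  · filter_upwards [hS] with x hx t ht
    rw [hf'S x hx, max_eq_left ht]

theorem primitive_congr {f' : E N → ℝ → ℝ} {x : E N} (h : ∀ t, 0 ≤ t → f x t = f' x t) {t : ℝ}
    (ht : 0 ≤ t) : primitive f x t = primitive f' x t := by
  refine intervalIntegral.integral_congr fun s hs => h s ?_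
  rw [Set.uIcc_of_le ht] at hs
  exact hs.1

theorem g_congr {f' : E N → ℝ → ℝ} {x : E N} (h : ∀ t, 0 ≤ t → f x t = f' x t) (u : E N → ℂ) :
    g f u x = g f' u x := by
  simp only [g, extendC, h 0 le_rfl, h _ (norm_nonneg (u x))]

end SubcriticalFunctional

open SubcriticalFunctional in
set_option maxHeartbeats 1000000 in
theorem mainTheorem11 (N : ℕ) (hN : 1 ≤ N)
    (f : SubcriticalFunctional.E N → ℝ → ℝ)
    (hf : SubcriticalFunctional.IsCaratheodory f)
    (hsub : SubcriticalFunctional.IsSubcritical f) :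
    -- `ψ` is well defined, and so is `g(u)` as a distribution
    (∀ u : SubcriticalFunctional.H1 N,
      Integrable (fun x => SubcriticalFunctional.primitive f x ‖SubcriticalFunctional.toFun u x‖)
        volume ∧
      LocallyIntegrable (SubcriticalFunctional.g f (SubcriticalFunctional.toFun u)) volume) ∧
    -- `G u` is `g(u)` as an element of `H⁻¹`, with its duality formula
    ∃ G : SubcriticalFunctional.H1 N → SubcriticalFunctional.Hneg1 N,
      (∀ u v : SubcriticalFunctional.H1 N,
        Integrable (fun x => SubcriticalFunctional.g f (SubcriticalFunctional.toFun u) x *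
          (starRingEnd ℂ) (SubcriticalFunctional.toFun v x)) volume ∧
        G u v = (∫ x, SubcriticalFunctional.g f (SubcriticalFunctional.toFun u) x *
          (starRingEnd ℂ) (SubcriticalFunctional.toFun v x)).re) ∧
      -- `ψ` is `C¹` with `ψ' = g`
      ContDiff ℝ 1 (SubcriticalFunctional.psi (N := N) f) ∧
      (∀ u : SubcriticalFunctional.H1 N,
        HasFDerivAt (SubcriticalFunctional.psi (N := N) f) (G u) u) ∧
      -- `ψ` and `ψ'` are bounded on bounded sets
      (∀ S : Set (SubcriticalFunctional.H1 N), Bornology.IsBounded S →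
        Bornology.IsBounded (SubcriticalFunctional.psi f '' S) ∧
        Bornology.IsBounded (G '' S)) ∧
      -- bounded sequences whose difference tends to `0` in some `Lᵖ`
      (∀ u v : ℕ → SubcriticalFunctional.H1 N,
        Bornology.IsBounded (Set.range u) → Bornology.IsBounded (Set.range v) →
        ∀ p : ℝ≥0∞, 1 ≤ p →
        Tendsto (fun n => eLpNorm
          (fun x => SubcriticalFunctional.toFun (u n) x - SubcriticalFunctional.toFun (v n) x)
          p volume) atTop (𝓝 0) →
        Tendsto (fun n => |SubcriticalFunctional.psi f (u n) - SubcriticalFunctional.psi f (v n)|)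
          atTop (𝓝 0)) ∧
      -- weak-to-weak sequential continuity of `g`
      (∀ (u : ℕ → SubcriticalFunctional.H1 N) (u₀ : SubcriticalFunctional.H1 N),
        Tendsto (fun n => toWeakSpace ℝ (SubcriticalFunctional.H1 N) (u n)) atTop
          (𝓝 (toWeakSpace ℝ (SubcriticalFunctional.H1 N) u₀)) →
        Tendsto (fun n => toWeakSpace ℝ (SubcriticalFunctional.Hneg1 N) (G (u n))) atTop
          (𝓝 (toWeakSpace ℝ (SubcriticalFunctional.Hneg1 N) (G u₀)))) := by
  obtain ⟨f', hf', hae⟩ := exists_isRegularNonlinearity hf hsub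
  obtain ⟨R, K, h⟩ := hf'.exists_hasGrowth
  have hm := hf'.measurable
  have hc := hf'.continuous
  have hprim : ∀ u : H1 N, (fun x => primitive f' x ‖toFun u x‖) =ᵐ[volume]
      fun x => primitive f x ‖toFun u x‖ := fun u => by
    filter_upwards [hae] with x hx
    exact (primitive_congr hx (norm_nonneg _)).symm
  have hg : ∀ u : H1 N, g f' (toFun u) =ᵐ[volume] g f (toFun u) := fun u => by
    filter_upwards [hae] with x hx
    exact (g_congr hx _).symm
  have hgm : ∀ u v : H1 N, (fun x => g f' (toFun u) x * (starRingEnd ℂ) (toFun v x)) =ᵐ[volume]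
      fun x => g f (toFun u) x * (starRingEnd ℂ) (toFun v x) := fun u v => by
    filter_upwards [hg u] with x hx
    rw [hx]
  have hpsi : psi f = psi f' := funext fun u => (integral_congr_ae (hprim u)).symm
  obtain ⟨G, hG⟩ := h.exists_dual hN hm
  have hGc := h.continuous_dual hN hm hc hG
  have hd : ∀ u, HasFDerivAt (psi f') (G u) u := fun u =>
    hasFDerivAt_of_hasDerivAt_line hGc (fun u v t => by
      rw [hG]
      exact h.hasDerivAt_psi_line hN hm hc u v t) u
  rw [hpsi]
  refine ⟨fun u => ⟨(h.integrable_primitive hN hm hc u).congr (hprim u), ?_⟩, G, fun u v =>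
    ⟨(h.integrable_g_mul hN hm u v).congr (hgm u v), ?_⟩, ?_, hd, fun S hS =>
    ⟨h.isBounded_image_psi hN hc hS, h.isBounded_image hN hm hG hS⟩, ?_, ?_⟩
  · exact (locallyIntegrable_congr (hg u)).1 (h.locallyIntegrable_g hN hm u)
  · rw [hG, pairing, integral_congr_ae (hgm u v)]
  · exact contDiff_one_iff_hasFDerivAt.2 ⟨G, hGc, hd⟩
  · exact fun u v hu hv p hp hlim => hf'.tendsto_psi_sub hN hu hv hp hlim
  · exact fun u u₀ hu => h.tendsto_weak hN hm hc hG hu
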